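/- **Setting.** Let $PV$ be a finite set of pointer variables containing a distinguished variable $\mathrm{nil}$, $k=|PV|$, and let $Y$ be a finite set of universal variables. Let $\mathbb D$ be a data domain, given as a first-order structure. Let $F$ be a set of quantifier-free formulas over the terms $w\to\mathrm{data}$ ($w\in PV\cup Y$), equipped with a bounded lattice structure $(F,\sqsubseteq,\sqcup,\sqcap,\mathit{false},\mathit{true})$ such that $\alpha\sqsubseteq\beta$ implies $\alpha\Rightarrow\beta$, distinct formulas of $F$ are non-equivalent, $\mathit{false}$ is unsatisfiable and $\mathit{true}$ is valid. We assume that, up to equivalence, $F$ contains $\exists d.\,\varphi[w_1\to\mathrm{data}/d,\dots,w_n\to\mathrm{data}/d]$ for all $\varphi\in F$ and $w_i\in PV\cup Y$, and the formulas $w\to\mathrm{data}=w'\to\mathrm{data}$ and $w\to\mathrm{data}=e$ for all $w,w'\in PV\cup Y$ and all data expressions $e$ of the programming language; below these formulas stand for their representatives in $F$. **Symbolic trees.** Let $\Pi=2^{PV}\times(Y\cup\{-\})$. A *symbolic tree* is a finite $\Pi$-labelled tree with ordered children such that at most $k$ nodes have more than one child, every leaf is labelled by at least one pointer variable, every variable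 of $PV\cup Y$ labels exactly one node, and the node labelled $\mathrm{nil}$ is a child of the root. (The parent of a node $v$ is $v\to\mathrm{next}$; the root is the unallocated location *dirty*.) A *formula tree* is a pair $(t,\varphi)$ of a symbolic tree $t$ and $\varphi\in F$. Let $label(t,p)\subseteq PV\cup Y$ be the set of variables labelling the same node of $t$ as $p$. **QSDAs.** A QSDA is a tuple $A=(Q,\Pi,\Delta,\mathcal T,f)$ with $Q$ finite, $\Delta=(\Delta_0,\dots,\Delta_k)$ with partial functions $\Delta_i:Q^i\times\Pi\rightharpoonup Q$, $\mathcal T:Q\to2^{PV\cup Y}$ and $f:Q\to F$. A run on $t$ labels every node $v$ with a state $\rho(v)$ such that, if $v$ has letter $(S,y)$ and children $v_1,\dots,v_i$ ($i\ge 0$): $\Delta_i(\rho(v_1),\dots,\rho(v_i),(S,y))=\rho(v)$; the set $S\cup(\{y\}\cap Y)$ is disjoint from every $\mathcal T(\rho(v_j))$; $\mathcal T(\rho(v))=S\cup(\{y\}\cap Y)\cup\bigcup_j\mathcal T(\rho(v_j))$; and $\mathcal T(\rho(v))\cap PV\neq\emptyset$ if $v$ is a leaf. $A$ accepts the formula tree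 $(t,\varphi)$ if it has a run on $t$ with state $q$ at the root such that $\mathcal T(q)=PV\cup Y$ and $f(q)=\varphi$. $L_f(A)$ is the set of formula trees accepted by $A$; a set of formula trees is *regular* if it is $L_f(A)$ for some QSDA $A$ (over the same $PV$, $Y$, $F$). **Updates.** $update(t,s,t')$ holds for symbolic trees $t,t'$ if executing $s$ on $t$ causes no memory error and no cycle, and yields $t'$, where locations not reachable from a pointer variable disappear (i.e. non-root nodes with no pointer variable at or below them are deleted), and the order of siblings is kept except that a newly attached child becomes the last one: * $p:=q$ moves the label $p$ to the node of $q$; $p:=\mathrm{nil}$ is the case $q=\mathrm{nil}$. * $p:=q\to\mathrm{next}$ moves the label $p$ to the parent of the node of $q$; it is an error if the node of $q$ is the root or the node of $\mathrm{nil}$. * $p\to\mathrm{next}:=q$ moves the subtree rooted at the node of $p$, making it the last child of the node of $q$; it is an error if the node of $p$ is the root or the node of $\mathrm{nil}$, and a cycle if $q$ lies in that subtree. $p\to\mathrm{next}:=\mathrm{nil}$ is the case $q=\mathrm{nil}$. * $new^y\,p$, for $y\in Y\cup\{-\}$, removes the labels $p$ and (if $y\ne-$) $y$, and adds a new last child of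 the root with letter $(\{p\},y)$. **Abstract transformer.** For a set $L$ of formula trees and a statement $s$, $F_f^\sharp(L)$ is the set of all formula trees $(t',\varphi')$ such that (the join of the empty set being $\mathit{false}$): * $p:=\mathrm{nil}$: $\varphi'=\bigsqcup\{\exists d.\,\varphi[p\to\mathrm{data}/d]\mid(t,\varphi)\in L,\ update(t,p:=\mathrm{nil},t')\}$. * $p:=q$: $\varphi'=(p\to\mathrm{data}=q\to\mathrm{data})\sqcap\bigsqcup\{\exists d.\,\varphi[p\to\mathrm{data}/d]\mid(t,\varphi)\in L,\ update(t,p:=q,t')\}$. * $p:=q\to\mathrm{next}$: $\varphi'=\bigsqcup\{\exists d.\,\varphi[p\to\mathrm{data}/d]\mid(t,\varphi)\in L,\ update(t,p:=q\to\mathrm{next},t')\}\sqcap\bigsqcap\{p\to\mathrm{data}=v\to\mathrm{data}\mid v\in label(t',p)\}$. * $s$ of the form $p\to\mathrm{next}:=\mathrm{nil}$ or $p\to\mathrm{next}:=q$: $\varphi'=\bigsqcup\{\varphi\mid(t,\varphi)\in L,\ update(t,s,t')\}$. * $p\to\mathrm{data}:=e$: for some $(t',\varphi)\in L$ and $\{v_1,\dots,v_\ell\}=label(t',p)$,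 $\varphi'=\exists d.\,\varphi[v_1\to\mathrm{data}/d,\dots,v_\ell\to\mathrm{data}/d]\sqcap\bigsqcap_{i}(v_i\to\mathrm{data}=e)$. * $\mathit{assume}\ \psi$ with $\psi$ a structural predicate (a Boolean combination of $p==q$, $p\to\mathrm{next}==q$, $p\to^*\mathrm{next}==q$): $(t',\varphi')\in L$ and $t'\models\psi$. * $\mathit{assume}\ \psi$ with $\psi\in F$ a data predicate: $\varphi'=\varphi\sqcap\psi$ for some $(t',\varphi)\in L$. * $new\ p$: let $y\in Y\cup\{-\}$ be the universal component of the letter of $t'$ at the node of $p$. If $y\in Y$, then $\varphi'=(y\to\mathrm{data}=p\to\mathrm{data})\sqcap\bigsqcup\{\exists d_1d_2.\,\varphi[p\to\mathrm{data}/d_1,y\to\mathrm{data}/d_2]\mid(t,\varphi)\in L,\ update(t,new^y\,p,t')\}$. If $y=-$, then $\varphi'=\bigsqcup\{\exists d.\,\varphi[p\to\mathrm{data}/d]\mid(t,\varphi)\in L,\ update(t,new^-\,p,t')\}$. **Lemma.** For every QSDA $A$ and every statement $s$ of the above forms, the language $F_f^\sharp(L_f(A))$ of formula trees is regular, i.e.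 there is a QSDA $A'$ with $L_f(A')=F_f^\sharp(L_f(A))$. -/

import Mathlib

universe u v

/-! ## Ordered finite labelled trees -/

/-- Finite trees with ordered children and `α`-labelled nodes. -/
inductive OTree (α : Type*) where
  | node : α → List (OTree α) → OTree α

namespace OTree

variable {α : Type*}

/-- The label of the root. -/
def label : OTree α → α
  | node a _ => a

/-- The subtrees at the children of the root, from left to right. -/
def children : OTree α → List (OTree α)
  | node _ cs => cs

/-- One entry for every node of the tree (in preorder), namely the subtree rooted there. -/
def nodes : OTree α → List (OTree α)
  | node a cs => node a cs :: cs.flatMap nodes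

/-- Relabel every node according to its old label and the old labels of its children. -/
def relabel (g : α → List α → α) : OTree α → OTree α
  | node a cs => node (g a (cs.map label)) (cs.map (relabel g))

end OTree

/-! ## Symbolic trees

An edge from a node down to a child `c` is a reversed `next` pointer: the parent of `c` is
`c → next`.  The root is the location `dirty`. -/

/-- The alphabet `Π = 2^PV × (Y ∪ {-})`; the symbol `-` is `none`. -/
abbrev Label (PV Y : Type*) := Finset PV × Option Y

/-- The variables (pointer and universal) that occur in a letter. -/
def Label.vars {PV Y : Type*} (a : Label PV Y) : Finset (PV ⊕ Y) :=
  a.1.disjSum a.2.toFinset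

/-- `Π`-labelled trees. -/
abbrev PTree (PV Y : Type*) := OTree (Label PV Y)

namespace PTree

variable {PV Y : Type*}

/-- The pointer variable `p` labels the root of `t`. -/
def AtRoot (p : PV) (t : PTree PV Y) : Prop := p ∈ t.label.1

instance [DecidableEq PV] (p : PV) (t : PTree PV Y) : Decidable (AtRoot p t) :=
  inferInstanceAs (Decidable (p ∈ t.label.1))

/-- Symbolic trees: valuation trees of heap skinny-trees with the data values left out. -/
structure IsSymbolic [Fintype PV] [DecidableEq PV] [DecidableEq Y] (nil : PV)
    (t : PTree PV Y) : Prop where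
  /-- At most `|PV|` nodes have more than one child. -/
  skinny : t.nodes.countP (fun s => 1 < s.children.length) ≤ Fintype.card PV
  /-- Every leaf is pointed to by some pointer variable. -/
  leaf : ∀ s ∈ t.nodes, s.children = [] → s.label.1.Nonempty
  /-- Every pointer variable labels exactly one node. -/
  pointer : ∀ p : PV, t.nodes.countP (fun s => p ∈ s.label.1) = 1
  /-- The node labelled `nil` is a child of the root. -/
  nil_child : ∃ c ∈ t.children, AtRoot nil c
  /-- Every universal variable labels exactly one node. -/
  universal : ∀ y : Y, t.nodes.countP (fun s => s.label.2 = some y) = 1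

/-- `label(t, p)`: all variables that label the same node of `t` as `p` (including `p`). -/
def coLabels [Fintype PV] [DecidableEq PV] [Fintype Y] [DecidableEq Y]
    (t : PTree PV Y) (p : PV) : Finset (PV ⊕ Y) :=
  Finset.univ.filter fun w => ∃ s ∈ t.nodes, AtRoot p s ∧ w ∈ Label.vars s.label

section Update

variable [DecidableEq PV]

/-- Some node of `t` is labelled with a pointer variable. -/
def HasPointer (t : PTree PV Y) : Prop := ∃ s ∈ t.nodes, s.label.1.Nonempty

instance (t : PTree PV Y) : Decidable (HasPointer t) :=
  inferInstanceAs (Decidable (∃ s ∈ t.nodes, s.label.1.Nonempty))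

/-- Locations that are not reachable from a pointer variable disappear from the memory: delete all
nodes (other than the root) below which, themselves included, there is no pointer variable. -/
def collect : PTree PV Y → PTree PV Y
  | .node a cs => .node a ((cs.map collect).filter fun c => HasPointer c)

/-- Delete the subtrees that are rooted at a node, other than the root, labelled `p`. -/
def cut (p : PV) : PTree PV Y → PTree PV Y
  | .node a cs => .node a ((cs.map (cut p)).filter fun c => ¬ AtRoot p c)

/-- Attach `s` as a new last child to the node labelled `p`. -/
def graft (p : PV) (s : PTree PV Y) : PTree PV Y → PTree PV Y
  | .node a cs => .node a (cs.map (graft p s) ++ if p ∈ a.1 then [s] else [])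

/-- Move the label `p` to the node labelled `q`. -/
def movePtr (p q : PV) (t : PTree PV Y) : PTree PV Y :=
  t.relabel fun a _ => (if q ∈ a.1 then insert p a.1 else a.1.erase p, a.2)

/-- Move the label `p` to the parent of the node labelled `q`. -/
def movePtrNext (p q : PV) (t : PTree PV Y) : PTree PV Y :=
  t.relabel fun a bs =>
    (if ∃ b ∈ bs, q ∈ b.1 then insert p a.1 else a.1.erase p, a.2)

/-- Erase the pointer label `p` and, if `y` is not `-`, the universal label `y`. -/
def eraseVars [DecidableEq Y] (p : PV) (y : Option Y) (t : PTree PV Y) : PTree PV Y :=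
  t.relabel fun a _ => (a.1.erase p, if a.2 = y then none else a.2)

/-- Attach a new last child to the root. -/
def addChild (s : PTree PV Y) : PTree PV Y → PTree PV Y
  | .node a cs => .node a (cs ++ [s])

/-- Dereferencing `p` is no memory error: `p` points neither to `dirty` nor to the `nil` node. -/
def Safe (nil p : PV) (t : PTree PV Y) : Prop :=
  ¬ AtRoot p t ∧ ∀ s ∈ t.nodes, AtRoot p s → ¬ AtRoot nil s

/-- `update(t, p := q, t')`. -/
def UpdateAssign (p q : PV) (t t' : PTree PV Y) : Prop :=
  t' = collect (movePtr p q t)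

/-- `update(t, p := q → next, t')`. -/
def UpdateLoad (nil p q : PV) (t t' : PTree PV Y) : Prop :=
  Safe nil q t ∧ t' = collect (movePtrNext p q t)

/-- `update(t, p → next := q, t')`.  The subtree `s` at `p` becomes a child of the node
of `q`, which must not lie in `s`, because the heap has to stay acyclic. -/
def UpdateStore (nil p q : PV) (t t' : PTree PV Y) : Prop :=
  Safe nil p t ∧ ∃ s ∈ t.nodes, AtRoot p s ∧ (∀ u ∈ s.nodes, ¬ AtRoot q u) ∧
    t' = collect (graft q s (cut p t))

/-- `update(t, new^y p, t')`: in `t'` the variables `p` and `y` (if `y` is not `-`) label a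
new child of the root; all the others keep their locations. -/
def UpdateNew [DecidableEq Y] (p : PV) (y : Option Y) (t t' : PTree PV Y) : Prop :=
  t' = addChild (.node ({p}, y) []) (collect (eraseVars p y t))

end Update

end PTree

/-! ## Structural predicates -/

/-- Structural predicates over the pointer variables. -/
inductive StructPred (PV : Type*) where
  | /-- `p == q` -/ eq (p q : PV)
  | /-- `p → next == q` -/ next (p q : PV)
  | /-- `p →* next == q` -/ reach (p q : PV)
  | not (ψ : StructPred PV)
  | and (ψ χ : StructPred PV)
  | or (ψ χ : StructPred PV)

/-- `t ⊨ ψ`. -/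
def PTree.Models {PV Y : Type*} (t : PTree PV Y) : StructPred PV → Prop
  | .eq p q => ∃ s ∈ t.nodes, AtRoot p s ∧ AtRoot q s
  | .next p q => ∃ s ∈ t.nodes, AtRoot q s ∧ ∃ c ∈ s.children, AtRoot p c
  | .reach p q => ∃ s ∈ t.nodes, AtRoot q s ∧ ∃ c ∈ s.nodes, AtRoot p c
  | .not ψ => ¬ Models t ψ
  | .and ψ χ => Models t ψ ∧ Models t χ
  | .or ψ χ => Models t ψ ∨ Models t χ

/-! ## Data formulas -/

/-- A lattice of data formulas over a data domain `D`, whose operations and predicates are those of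
the first-order language `L`.  The variable `w : PV ⊕ Y` stands for the term `w → data`.
The last three fields say that the formulas which the abstract transformer uses are, up to
equivalence, available in the lattice. -/
structure DataFormulas (L : FirstOrder.Language.{u, v}) (D : Type*) [L.Structure D] (PV Y : Type*)
    [DecidableEq PV] [DecidableEq Y] where
  /-- The set of data formulas. -/
  Formulas : Set (L.Formula (PV ⊕ Y))
  isQF : ∀ φ ∈ Formulas, φ.IsQF
  [lattice : Lattice Formulas]
  [boundedOrder : BoundedOrder Formulas]
  bot_false : ∀ r : PV ⊕ Y → D, ¬ (⊥ : Formulas).1.Realize r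
  top_true : ∀ r : PV ⊕ Y → D, (⊤ : Formulas).1.Realize r
  imp_of_le : ∀ φ ψ : Formulas, φ ≤ ψ → ∀ r : PV ⊕ Y → D, φ.1.Realize r → ψ.1.Realize r
  /-- Different formulas are not equivalent. -/
  canonical : ∀ φ ψ : Formulas,
    (∀ r : PV ⊕ Y → D, φ.1.Realize r ↔ ψ.1.Realize r) → φ = ψ
  /-- The data expressions of the programming language. -/
  Exprs : Set (L.Term PV)
  exists_mem : ∀ (X : Finset (PV ⊕ Y)) (φ : Formulas), ∃ ψ : Formulas,
    ∀ r : PV ⊕ Y → D, ψ.1.Realize r ↔ ∃ d : D, φ.1.Realize fun w => if w ∈ X then d else r w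
  eq_mem : ∀ w w' : PV ⊕ Y, ∃ ψ : Formulas,
    ∀ r : PV ⊕ Y → D, ψ.1.Realize r ↔ r w = r w'
  eqExpr_mem : ∀ (w : PV ⊕ Y) (e : Exprs), ∃ ψ : Formulas,
    ∀ r : PV ⊕ Y → D, ψ.1.Realize r ↔ r w = e.1.realize fun p => r (Sum.inl p)

attribute [instance] DataFormulas.lattice DataFormulas.boundedOrder

namespace DataFormulas

variable {L : FirstOrder.Language.{u, v}} {D : Type*} [L.Structure D] {PV Y : Type*}
  [DecidableEq PV] [DecidableEq Y]

/-- The formula `∃ d. φ[w₁ → data / d, …, wₙ → data / d]`, where `X = {w₁, …, wₙ}`. -/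
noncomputable def ex (F : DataFormulas L D PV Y) (X : Finset (PV ⊕ Y)) (φ : F.Formulas) :
    F.Formulas :=
  (F.exists_mem X φ).choose

/-- The formula `w → data = w' → data`. -/
noncomputable def eqData (F : DataFormulas L D PV Y) (w w' : PV ⊕ Y) : F.Formulas :=
  (F.eq_mem w w').choose

/-- The formula `w → data = e`. -/
noncomputable def eqExpr (F : DataFormulas L D PV Y) (w : PV ⊕ Y) (e : F.Exprs) : F.Formulas :=
  (F.eqExpr_mem w e).choose

end DataFormulas

/-! ## Quantified skinny-tree data automata -/

/-- Quantified skinny-tree data automata.  The partial functions `Δᵢ : Qⁱ × Π → Q`, for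
`0 ≤ i ≤ |PV|`, are combined into `step`. -/
structure QSDA {L : FirstOrder.Language.{u, v}} {D : Type*} [L.Structure D] {PV Y : Type*} [Fintype PV]
    [DecidableEq PV] [DecidableEq Y] (F : DataFormulas L D PV Y) where
  Q : Type
  [finite : Finite Q]
  step : List Q → Label PV Y → Option Q
  step_rank : ∀ qs a, Fintype.card PV < qs.length → step qs a = none
  type : Q → Finset (PV ⊕ Y)
  out : Q → F.Formulas

namespace QSDA

variable {L : FirstOrder.Language.{u, v}} {D : Type*} [L.Structure D] {PV Y : Type*} [Fintype PV]
  [DecidableEq PV] [DecidableEq Y] {F : DataFormulas L D PV Y}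

/-- A node with letter `a` whose children carry the states `qs` may carry the state `q`. -/
structure Trans (A : QSDA F) (qs : List A.Q) (a : Label PV Y) (q : A.Q) : Prop where
  step_eq : A.step qs a = some q
  leaf : qs = [] → ∃ p : PV, Sum.inl p ∈ A.type q
  disjoint : ∀ q' ∈ qs, Disjoint (Label.vars a) (A.type q')
  type_eq : ∀ w, w ∈ A.type q ↔ w ∈ Label.vars a ∨ ∃ q' ∈ qs, w ∈ A.type q'

/-- The states that `A` reaches at the root of a tree (at most one, as `A` is deterministic). -/
def reach (A : QSDA F) : PTree PV Y → Set A.Q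
  | .node a cs => {q | ∃ qs : List A.Q,
      List.Forall₂ (fun q' R => q' ∈ R) qs (cs.map A.reach) ∧ A.Trans qs a q}

/-- `L_f(A)`: the formula trees accepted by `A`. -/
def formulaTrees (A : QSDA F) (nil : PV) : Set (PTree PV Y × F.Formulas) :=
  {x | PTree.IsSymbolic nil x.1 ∧
    ∃ q ∈ A.reach x.1, (∀ w, w ∈ A.type q) ∧ A.out q = x.2}

end QSDA

/-- A set of formula trees is regular if some QSDA accepts it. -/
def IsRegularFormulaLanguage {L : FirstOrder.Language.{u, v}} {D : Type*} [L.Structure D] {PV Y : Type*}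
    [Fintype PV] [DecidableEq PV] [DecidableEq Y] {F : DataFormulas L D PV Y} (nil : PV)
    (𝓛 : Set (PTree PV Y × F.Formulas)) : Prop :=
  ∃ A : QSDA F, A.formulaTrees nil = 𝓛

/-! ## Statements and the abstract transformer -/

/-- The statements of the programming language. -/
inductive Stmt {L : FirstOrder.Language.{u, v}} {D : Type*} [L.Structure D] {PV Y : Type*}
    [DecidableEq PV] [DecidableEq Y] (F : DataFormulas L D PV Y) where
  | /-- `p := nil` -/ assignNil (p : PV)
  | /-- `p := q` -/ assign (p q : PV)
  | /-- `p := q → next` -/ load (p q : PV)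
  | /-- `p → next := nil` -/ storeNil (p : PV)
  | /-- `p → next := q` -/ store (p q : PV)
  | /-- `p → data := e` -/ storeData (p : PV) (e : F.Exprs)
  | /-- `assume ψ`, structural -/ assumeStruct (ψ : StructPred PV)
  | /-- `assume ψ`, on data -/ assumeData (ψ : F.Formulas)
  | /-- `new p` -/ new (p : PV)

section Transformer

variable {L : FirstOrder.Language.{u, v}} {D : Type*} [L.Structure D] {PV Y : Type*} [Fintype PV]
  [DecidableEq PV] [Fintype Y] [DecidableEq Y] {F : DataFormulas L D PV Y}

/-- `σ` is the join of all `h φ` where `(t, φ) ∈ 𝓛` and `update t t'`. -/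
def IsJoinOver (𝓛 : Set (PTree PV Y × F.Formulas)) (update : PTree PV Y → PTree PV Y → Prop)
    (h : F.Formulas → F.Formulas) (t' : PTree PV Y) (σ : F.Formulas) : Prop :=
  IsLUB {ψ | ∃ t φ, (t, φ) ∈ 𝓛 ∧ update t t' ∧ ψ = h φ} σ

/-- The relation `(t', φ') ∈ F_f^♯(𝓛)` for symbolic trees `t'`, statement by statement. -/
def TransformerRel (nil : PV) (𝓛 : Set (PTree PV Y × F.Formulas)) (t' : PTree PV Y)
    (φ' : F.Formulas) : Stmt F → Prop
  | .assignNil p =>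
      IsJoinOver 𝓛 (PTree.UpdateAssign p nil) (F.ex {.inl p}) t' φ'
  | .assign p q =>
      ∃ σ, IsJoinOver 𝓛 (PTree.UpdateAssign p q) (F.ex {.inl p}) t' σ ∧
        φ' = F.eqData (.inl p) (.inl q) ⊓ σ
  | .load p q =>
      ∃ σ, IsJoinOver 𝓛 (PTree.UpdateLoad nil p q) (F.ex {.inl p}) t' σ ∧
        φ' = σ ⊓ (PTree.coLabels t' p).inf fun w => F.eqData (.inl p) w
  | .storeNil p =>
      IsJoinOver 𝓛 (PTree.UpdateStore nil p nil) id t' φ'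
  | .store p q =>
      IsJoinOver 𝓛 (PTree.UpdateStore nil p q) id t' φ'
  | .storeData p e =>
      ∃ φ, (t', φ) ∈ 𝓛 ∧
        φ' = F.ex (PTree.coLabels t' p) φ ⊓ (PTree.coLabels t' p).inf fun w => F.eqExpr w e
  | .assumeStruct ψ => (t', φ') ∈ 𝓛 ∧ PTree.Models t' ψ
  | .assumeData ψ => ∃ φ, (t', φ) ∈ 𝓛 ∧ φ' = φ ⊓ ψ
  | .new p =>
      -- either no universal variable or exactly one shares the node of `p` in `t'`
      ((∃ s ∈ t'.nodes, PTree.AtRoot p s ∧ s.label.2 = none) ∧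
        IsJoinOver 𝓛 (PTree.UpdateNew p none) (F.ex {.inl p}) t' φ') ∨
      ∃ y : Y, (∃ s ∈ t'.nodes, PTree.AtRoot p s ∧ s.label.2 = some y) ∧
        ∃ σ, IsJoinOver 𝓛 (PTree.UpdateNew p (some y))
            (fun φ => F.ex {.inr y} (F.ex {.inl p} φ)) t' σ ∧
          φ' = F.eqData (.inr y) (.inl p) ⊓ σ

/-- The abstract transformer `F_f^♯` of a statement on languages of formula trees. -/
def transformer (nil : PV) (s : Stmt F) (𝓛 : Set (PTree PV Y × F.Formulas)) :
    Set (PTree PV Y × F.Formulas) :=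
  {x | PTree.IsSymbolic nil x.1 ∧ TransformerRel nil 𝓛 x.1 x.2 s}

end Transformer

/-!
Since an automaton is deterministic and symbolic trees have at most `|PV|` leaves, a set of formula
trees is regular as soon as it is the graph of a partial function `G` from symbolic trees to
formulas that is *recognizable*, i.e. factors through a finite bottom-up evaluation
(`QSDA.isRegular_of_recognizable`).  The states of the automaton pair the value of a subtree with
the set of its variables; at the root, which is recognized by its child labelled `nil`, the run
stops if `G` is undefined.

If a statement leaves the shape of the tree alone, the new formula is a function of the old one
and of recognizable properties of the tree.  For the other statements, the formula attached to a
tree `t'` is determined by the set of states in which the predecessors of `t'` under the update are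
accepted (`QSDA.RecognizablePost`), and by such properties of `t'` as the letter at `p`.  It remains
to compute that set of states bottom-up.

* If the update relabels the nodes and deletes some subtrees, the set of possible old values at a
  node is computed from those at its children by a powerset construction, which guesses the old
  letter and inserts values of deleted subtrees anywhere between the children
  (`Recognizable.image`).  This covers `p := q`, `p := q → next` and, after removal of the
  last child of the root, `new p`.
* For `p → next := q` this applies to the tree without its subtree `s` at `p`.  As the evaluation
  cannot distinguish `s` from another subtree of the same value (`PTree.eval_plug`), it is enough
  that `p` labels the last child of the node of `q` in `t'`, and that some old tree, with a subtree
  at `p` of the same value as `s`, yields `t'` without `s` (`QSDA.recognizablePost_store`).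
-/

/-! ### Induction and membership for ordered trees -/

namespace OTree

variable {α : Type*}

theorem induction {P : OTree α → Prop} (h : ∀ a cs, (∀ c ∈ cs, P c) → P (node a cs)) :
    ∀ t, P t
  | node a cs => h a cs fun c _ => induction h c

theorem mem_nodes_node {a : α} {cs : List (OTree α)} {s : OTree α} :
    s ∈ (node a cs).nodes ↔ s = node a cs ∨ ∃ c ∈ cs, s ∈ c.nodes := by
  rw [nodes, List.mem_cons, List.mem_flatMap]

theorem self_mem_nodes (t : OTree α) : t ∈ t.nodes := by
  cases t; exact mem_nodes_node.2 (Or.inl rfl)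

theorem mem_nodes_trans {s u t : OTree α} (hs : s ∈ u.nodes) (hu : u ∈ t.nodes) :
    s ∈ t.nodes := by
  induction t using induction with
  | h a cs ih =>
    rcases mem_nodes_node.1 hu with rfl | ⟨c, hc, huc⟩
    · exact hs
    · exact mem_nodes_node.2 (Or.inr ⟨c, hc, ih c hc huc⟩)

theorem mem_nodes_of_mem_children {c t : OTree α} (hc : c ∈ t.children) : c ∈ t.nodes := by
  cases t; exact mem_nodes_node.2 (Or.inr ⟨c, hc, self_mem_nodes c⟩)

theorem countP_nodes_node (P : OTree α → Bool) (a : α) (cs : List (OTree α)) :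
    (node a cs).nodes.countP P =
      (if P (node a cs) then 1 else 0) + (cs.map fun c => c.nodes.countP P).sum := by
  rw [nodes, List.countP_cons, List.countP_flatMap, add_comm]
  rfl

end OTree

theorem List.eq_of_countP_eq_one {α : Type*} {P : α → Bool} {l : List α} (h : l.countP P = 1)
    {x y : α} (hx : x ∈ l) (hy : y ∈ l) (hPx : P x) (hPy : P y) : x = y := by
  rw [List.countP_eq_length_filter, List.length_eq_one_iff] at h
  obtain ⟨z, hz⟩ := h
  have h1 : x ∈ l.filter P := List.mem_filter.2 ⟨hx, hPx⟩
  have h2 : y ∈ l.filter P := List.mem_filter.2 ⟨hy, hPy⟩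
  rw [hz, List.mem_singleton] at h1 h2
  rw [h1, h2]

/-! ### Recognizable functions on trees -/

/-- A function on trees is recognizable if it factors through a finite bottom-up evaluation.
The value at a node may depend in any way on the list of values at its children: nothing is asked
of the number of children, because only trees of bounded rank matter in the end. -/
def Recognizable {α β : Type*} (G : OTree α → β) : Prop :=
  ∃ (n : ℕ) (e : OTree α → Fin n) (step : α → List (Fin n) → Fin n) (out : Fin n → β),
    (∀ a cs, e (.node a cs) = step a (cs.map e)) ∧ ∀ t, G t = out (e t)

namespace Recognizable

variable {α β γ δ : Type*}

/-- A function with finitely many values that can be evaluated bottom-up. -/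
theorem of_step [Finite γ] {G : OTree α → γ} (step : α → List γ → γ)
    (h : ∀ a cs, G (.node a cs) = step a (cs.map G)) : Recognizable G := by
  obtain ⟨n, ⟨f⟩⟩ := Finite.exists_equiv_fin γ
  refine ⟨n, f ∘ G, fun a l => f (step a (l.map f.symm)), f.symm, fun a cs => ?_, fun t => ?_⟩
  · simp [h, Function.comp_def]
  · simp

theorem comp {G : OTree α → β} (hG : Recognizable G) (h : β → γ) :
    Recognizable fun t => h (G t) := by
  obtain ⟨n, e, step, out, he, hout⟩ := hG
  exact ⟨n, e, step, h ∘ out, he, fun t => by simp [hout]⟩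

/-- A function with finitely many values that can be evaluated bottom-up with the help of a
recognizable function. -/
theorem fix [Finite γ] {G : OTree α → γ} {H : OTree α → β} (hH : Recognizable H)
    (Φ : β → α → List (γ × β) → γ)
    (h : ∀ a cs, G (.node a cs) = Φ (H (.node a cs)) a (cs.map fun c => (G c, H c))) :
    Recognizable G := by
  obtain ⟨n, e, step, out, he, hout⟩ := hH
  have key : Recognizable fun t => (G t, e t) := by
    refine of_step (fun a l => (Φ (out (step a (l.map Prod.snd))) a
      (l.map fun x => (x.1, out x.2)), step a (l.map Prod.snd))) fun a cs => ?_
    simp [h, he, hout, Function.comp_def]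
  exact key.comp Prod.fst

theorem prod {G : OTree α → β} {H : OTree α → γ} (hG : Recognizable G) (hH : Recognizable H) :
    Recognizable fun t => (G t, H t) := by
  obtain ⟨n, e, step, out, he, hout⟩ := hG
  obtain ⟨n', e', step', out', he', hout'⟩ := hH
  have key : Recognizable fun t => (e t, e' t) := by
    refine of_step (fun a l => (step a (l.map Prod.fst), step' a (l.map Prod.snd))) fun a cs => ?_
    simp [he, he', Function.comp_def]
  simpa only [hout, hout'] using key.comp fun x => (out x.1, out' x.2)

theorem comp₂ {G : OTree α → β} {H : OTree α → γ} (hG : Recognizable G) (hH : Recognizable H)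
    (h : β → γ → δ) : Recognizable fun t => h (G t) (H t) :=
  (hG.prod hH).comp fun x => h x.1 x.2

theorem const (b : β) : Recognizable fun _ : OTree α => b :=
  (of_step (G := fun _ : OTree α => ()) (fun _ _ => ()) fun _ _ => rfl).comp fun _ => b

theorem label [Finite α] : Recognizable (OTree.label : OTree α → α) :=
  of_step (fun a _ => a) fun _ _ => rfl

theorem pi {ι : Type*} [Finite ι] {G : ι → OTree α → β} (hG : ∀ i, Recognizable (G i)) :
    Recognizable fun t i => G i t := by
  choose n e step out he hout using hG
  have key : Recognizable fun t i => e i t := by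
    refine of_step (fun a l i => step i a (l.map fun x => x i)) fun a cs => ?_
    funext i
    simp [he, Function.comp_def]
  simpa only [hout] using key.comp fun x i => out i (x i)

/-- The set of values of a recognizable function at all subtrees. -/
theorem nodes {H : OTree α → β} (hH : Recognizable H) :
    Recognizable fun t => {b | ∃ s ∈ t.nodes, H s = b} := by
  obtain ⟨n, e, step, out, he, hout⟩ := hH
  have he' : Recognizable e := of_step step he
  have key : Recognizable fun t => {x | ∃ s ∈ t.nodes, e s = x} := by
    refine fix he' (fun x _ l => {y | y = x ∨ ∃ z ∈ l, y ∈ z.1}) fun a cs => ?_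
    ext y
    simp only [OTree.mem_nodes_node, Set.mem_ofPred_eq, List.mem_map]
    constructor
    · rintro ⟨s, rfl | ⟨c, hc, hs⟩, rfl⟩
      · exact Or.inl rfl
      · exact Or.inr ⟨_, ⟨c, hc, rfl⟩, s, hs, rfl⟩
    · rintro (rfl | ⟨_, ⟨c, hc, rfl⟩, s, hs, rfl⟩)
      · exact ⟨_, Or.inl rfl, rfl⟩
      · exact ⟨s, Or.inr ⟨c, hc, hs⟩, rfl⟩
  convert key.comp fun X => out '' X using 2 with t
  ext b
  simp [hout]

theorem forall_nodes {P : OTree α → Prop} (hP : Recognizable P) :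
    Recognizable fun t => ∀ s ∈ t.nodes, P s := by
  convert hP.nodes.comp fun X => False ∉ X using 2 with t
  simp

theorem exists_nodes {P : OTree α → Prop} (hP : Recognizable P) :
    Recognizable fun t => ∃ s ∈ t.nodes, P s := by
  convert hP.nodes.comp fun X => True ∈ X using 2 with t
  simp

theorem exists_children {P : OTree α → Prop} (hP : Recognizable P) :
    Recognizable fun t => ∃ c ∈ t.children, P c := by
  refine fix hP (fun _ _ l => ∃ x ∈ l, x.2) fun a cs => ?_
  simp [OTree.children]

/-- Counting nodes up to a threshold. -/
theorem min_countP {P : OTree α → Bool} (hP : Recognizable P) (N : ℕ) :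
    Recognizable fun t => min (t.nodes.countP P) N := by
  have key : Recognizable fun t => (⟨min (t.nodes.countP P) N, by omega⟩ : Fin (N + 1)) := by
    refine fix hP (fun b _ l => ⟨min ((if b then 1 else 0) + (l.map fun x => x.1.1).sum) N,
      by omega⟩) fun a cs => ?_
    have aux : ∀ l : List ℕ, ∀ m, min (m + l.sum) N = min (m + (l.map (min · N)).sum) N := by
      intro l
      induction l with
      | nil => simp
      | cons x l ih =>
        intro m
        have h1 := ih (m + x)
        have h2 := ih (m + min x N)
        simp only [List.sum_cons, List.map_cons] at *
        rcases le_total x N with hx | hx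
        · rw [min_eq_left hx]; omega
        · rw [min_eq_right hx]; omega
    ext
    simp only [OTree.countP_nodes_node, List.map_map, Function.comp_def]
    rw [aux]
    simp [Function.comp_def]
  exact key.comp Fin.val

/-- Direct images under transformations that relabel all nodes and delete some subtrees: an
automaton that reads the result guesses the old labels and the values of the deleted subtrees. -/
theorem image {f : OTree α → OTree α} {I : OTree α → γ} {keep : OTree α → Bool}
    (g : α → List γ → α) (hI : Recognizable I) (hkeep : Recognizable fun t => keep (f t))
    (hf : ∀ a cs, f (.node a cs) = .node (g a (cs.map I)) ((cs.map f).filter keep))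
    {H : OTree α → β} (hH : Recognizable H) :
    Recognizable fun t' => {b | ∃ t, f t = t' ∧ H t = b} := by
  obtain ⟨n, e, step, out, he, hout⟩ := (hI.prod hkeep).prod hH
  have hI' : I = fun t => (out (e t)).1.1 := funext fun t => by rw [← hout]
  have hk' : ∀ t, keep (f t) = (out (e t)).1.2 := fun t => by rw [← hout]
  have hH' : ∀ t, H t = (out (e t)).2 := fun t => by rw [← hout]
  have key : Recognizable fun t' => {x | ∃ t, f t = t' ∧ e t = x} := by
    refine of_step (fun a' L => {x | ∃ a l, x = step a l ∧ g a (l.map fun y => (out y).1.1) = a' ∧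
      List.Forall₂ (fun y X => y ∈ X) (l.filter fun y => (out y).1.2) L ∧
      ∀ y ∈ l, y ∈ Set.range e}) fun a' cs' => ?_
    ext x
    constructor
    · rintro ⟨⟨a, cs⟩, hft, rfl⟩
      rw [hf, OTree.node.injEq] at hft
      obtain ⟨h1, rfl⟩ := hft
      refine ⟨a, cs.map e, he a cs, ?_, ?_, ?_⟩
      · simpa [Function.comp_def, hI'] using h1
      · clear h1
        induction cs with
        | nil => simp
        | cons c cs ih =>
          simp only [List.map_cons, List.filter_cons, hk']
          split_ifs
          · exact List.Forall₂.cons ⟨c, rfl, rfl⟩ ih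
          · exact ih
      · simp
    · rintro ⟨a, l, rfl, rfl, h2, h3⟩
      suffices h : ∃ cs : List (OTree α), cs.map e = l ∧ (cs.map f).filter keep = cs' by
        obtain ⟨cs, rfl, rfl⟩ := h
        refine ⟨.node a cs, ?_, he a cs⟩
        simp [hf, hI', Function.comp_def]
      induction l generalizing cs' with
      | nil =>
        cases cs' with
        | nil => exact ⟨[], rfl, rfl⟩
        | cons c cs' => simp at h2
      | cons y l ih =>
        simp only [List.mem_cons, forall_eq_or_imp] at h3
        rw [List.filter_cons] at h2
        split_ifs at h2 with hy
        · cases cs' with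
          | nil => simp at h2
          | cons c' cs' =>
            rw [List.map_cons, List.forall₂_cons] at h2
            obtain ⟨⟨t, rfl, rfl⟩, h2⟩ := h2
            obtain ⟨cs, rfl, rfl⟩ := ih cs' h2 h3.2
            exact ⟨t :: cs, rfl, by simp [hk', hy]⟩
        · obtain ⟨t, rfl⟩ := h3.1
          obtain ⟨cs, rfl, rfl⟩ := ih cs' h2 h3.2
          exact ⟨t :: cs, rfl, by simp [hk', hy]⟩
  convert key.comp fun X => (fun x => (out x).2) '' X using 2 with t'
  ext b
  simp [hH']

end Recognizable

/-! ### Symbolic trees -/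

theorem List.le_sum_map_of_mem {α : Type*} {l : List α} {x : α} (h : x ∈ l) (f : α → ℕ) :
    f x ≤ (l.map f).sum :=
  List.le_sum_of_mem (List.mem_map_of_mem h)

namespace OTree

variable {α : Type*}

theorem countP_nodes_le {P : OTree α → Bool} {s t : OTree α} (hs : s ∈ t.nodes) :
    s.nodes.countP P ≤ t.nodes.countP P := by
  induction t using induction with
  | h a cs ih =>
    rcases mem_nodes_node.1 hs with rfl | ⟨c, hc, hsc⟩
    · exact le_rfl
    · rw [countP_nodes_node]
      exact (ih c hc hsc).trans ((List.le_sum_map_of_mem hc fun c => c.nodes.countP P).trans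
        (Nat.le_add_left _ _))

theorem one_le_countP_nodes {P : OTree α → Bool} {s t : OTree α} (hs : s ∈ t.nodes)
    (hP : P s) : 1 ≤ t.nodes.countP P :=
  List.countP_pos_iff.2 ⟨s, hs, hP⟩

end OTree

namespace PTree

variable {PV Y : Type*}

/-- All variables that occur in a tree. -/
noncomputable def vars [Fintype PV] [Fintype Y] (t : PTree PV Y) : Finset (PV ⊕ Y) :=
  open Classical in Finset.univ.filter fun w => ∃ s ∈ t.nodes, w ∈ Label.vars s.label

theorem mem_vars [Fintype PV] [Fintype Y] {t : PTree PV Y} {w : PV ⊕ Y} :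
    w ∈ vars t ↔ ∃ s ∈ t.nodes, w ∈ Label.vars s.label := by
  simp [vars]

theorem inl_mem_label_vars {a : Label PV Y} {p : PV} : Sum.inl p ∈ Label.vars a ↔ p ∈ a.1 := by
  simp [Label.vars]

theorem inr_mem_label_vars {a : Label PV Y} {y : Y} :
    Sum.inr y ∈ Label.vars a ↔ a.2 = some y := by
  simp [Label.vars]

theorem hasPointer_of_leaf {t : PTree PV Y}
    (h : ∀ s ∈ t.nodes, s.children = [] → s.label.1.Nonempty) : HasPointer t := by
  induction t using OTree.induction with
  | h a cs ih =>
    cases cs with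
    | nil => exact ⟨_, OTree.self_mem_nodes _, h _ (OTree.self_mem_nodes _) rfl⟩
    | cons c cs =>
      obtain ⟨s, hs, hp⟩ := ih c (by simp) fun s hs =>
        h s (OTree.mem_nodes_node.2 (Or.inr ⟨c, by simp, hs⟩))
      exact ⟨s, OTree.mem_nodes_node.2 (Or.inr ⟨c, by simp, hs⟩), hp⟩

namespace IsSymbolic

variable [Fintype PV] [DecidableEq PV] [DecidableEq Y] {nil : PV} {t : PTree PV Y}

theorem hasPointer (h : IsSymbolic nil t) {s : PTree PV Y} (hs : s ∈ t.nodes) : HasPointer s :=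
  hasPointer_of_leaf fun u hu => h.leaf u (OTree.mem_nodes_trans hu hs)

theorem exists_atRoot (h : IsSymbolic nil t) (p : PV) : ∃ s ∈ t.nodes, AtRoot p s := by
  have := List.countP_pos_iff.1 ((h.pointer p).symm ▸ Nat.one_pos)
  simpa [AtRoot] using this

theorem eq_of_atRoot (h : IsSymbolic nil t) {p : PV} {s u : PTree PV Y} (hs : s ∈ t.nodes)
    (hu : u ∈ t.nodes) (hps : AtRoot p s) (hpu : AtRoot p u) : s = u :=
  List.eq_of_countP_eq_one (h.pointer p) hs hu (decide_eq_true hps) (decide_eq_true hpu)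

theorem countP_vars (h : IsSymbolic nil t) (w : PV ⊕ Y) :
    t.nodes.countP (fun s => w ∈ Label.vars s.label) = 1 := by
  cases w with
  | inl p => simpa only [inl_mem_label_vars] using h.pointer p
  | inr y => simpa only [inr_mem_label_vars] using h.universal y

theorem mem_vars [Fintype Y] (h : IsSymbolic nil t) (w : PV ⊕ Y) : w ∈ vars t := by
  rw [PTree.mem_vars]
  have := List.countP_pos_iff.1 ((h.countP_vars w).symm ▸ Nat.one_pos)
  simpa using this

theorem disjoint_vars [Fintype Y] (h : IsSymbolic nil t) {s c : PTree PV Y} (hs : s ∈ t.nodes)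
    (hc : c ∈ s.children) : Disjoint (Label.vars s.label) (vars c) := by
  rw [Finset.disjoint_left]
  intro w hw hwc
  obtain ⟨u, hu, hwu⟩ := PTree.mem_vars.1 hwc
  have h1 := OTree.countP_nodes_le (P := fun s => decide (w ∈ Label.vars s.label)) hs
  rw [h.countP_vars w] at h1
  obtain ⟨a, cs⟩ := s
  rw [OTree.countP_nodes_node, if_pos (by simpa using hw)] at h1
  have h2 := OTree.one_le_countP_nodes (P := fun s => decide (w ∈ Label.vars s.label)) hu
    (by simpa using hwu)
  have h3 := List.le_sum_map_of_mem hc fun c : PTree PV Y =>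
    c.nodes.countP (fun s => decide (w ∈ Label.vars s.label))
  exact absurd ((Nat.add_le_add_left (h2.trans h3) 1).trans h1) (by decide)

/-- The subtrees at the children of a node contain pairwise different pointer variables. -/
theorem length_children_le (h : IsSymbolic nil t) {s : PTree PV Y} (hs : s ∈ t.nodes) :
    s.children.length ≤ Fintype.card PV := by
  have key : ∀ cs : List (PTree PV Y), (∀ c ∈ cs, HasPointer c) →
      cs.length ≤ ∑ p : PV, (cs.map fun c => c.nodes.countP fun u => p ∈ u.label.1).sum := by
    intro cs hcs
    induction cs with
    | nil => simp
    | cons c cs ih =>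
      simp only [List.map_cons, List.sum_cons, Finset.sum_add_distrib, List.length_cons]
      have h1 := ih fun c hc => hcs c (by simp [hc])
      obtain ⟨u, hu, p, hp⟩ := hcs c (by simp)
      have h2 := OTree.one_le_countP_nodes (P := fun u => decide (p ∈ u.label.1)) hu
        (by simpa using hp)
      have h3 := Finset.single_le_sum (f := fun p : PV => c.nodes.countP fun u => p ∈ u.label.1)
        (fun _ _ => Nat.zero_le _) (Finset.mem_univ p)
      omega
  refine (key _ fun c hc => h.hasPointer
    (OTree.mem_nodes_trans (OTree.mem_nodes_of_mem_children hc) hs)).trans ?_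
  rw [Fintype.card_eq_sum_ones]
  refine Finset.sum_le_sum fun p _ => ?_
  have h1 := OTree.countP_nodes_le (P := fun s => decide (p ∈ s.label.1)) hs
  rw [h.pointer p] at h1
  obtain ⟨a, cs⟩ := s
  rw [OTree.countP_nodes_node] at h1
  exact (Nat.le_add_left _ _).trans h1

/-- Below the root of a symbolic tree, no node has the node labelled `nil` as a child. -/
theorem not_nil_child (h : IsSymbolic nil t) {c s : PTree PV Y} (hc : c ∈ t.children)
    (hs : s ∈ c.nodes) : ¬ ∃ d ∈ s.children, AtRoot nil d := by
  rintro ⟨d, hd, hnil⟩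
  obtain ⟨b, hb, hbnil⟩ := h.nil_child
  set N : PTree PV Y → ℕ := fun u => u.nodes.countP fun u => nil ∈ u.label.1 with hN
  set B : PTree PV Y → ℕ := fun u => if nil ∈ u.label.1 then 1 else 0 with hB
  set S : PTree PV Y → ℕ := fun u => (u.children.map N).sum with hS
  have hNBS : ∀ u, N u = B u + S u := by
    rintro ⟨a, cs⟩
    simp [hN, hB, hS, OTree.countP_nodes_node, OTree.children]
  have h1 : B t + S t = 1 := by rw [← hNBS]; exact h.pointer nil
  have h2 : S t = (t.children.map B).sum + (t.children.map S).sum := by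
    rw [← List.sum_map_add]
    exact congrArg (fun f => (t.children.map f).sum) (funext hNBS)
  have h3 : 1 ≤ (t.children.map B).sum := by
    refine le_trans ?_ (List.le_sum_map_of_mem hb B)
    simp [hB, show nil ∈ b.label.1 from hbnil]
  have h4 : 1 ≤ S c := by
    obtain ⟨a, cs⟩ := c
    have : ∃ e ∈ cs, d ∈ e.nodes := by
      rcases OTree.mem_nodes_node.1 hs with rfl | ⟨e, he, hse⟩
      · exact ⟨d, hd, OTree.self_mem_nodes d⟩
      · exact ⟨e, he, OTree.mem_nodes_trans (OTree.mem_nodes_of_mem_children hd) hse⟩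
    obtain ⟨e, he, hde⟩ := this
    exact (OTree.one_le_countP_nodes hde (decide_eq_true hnil)).trans
      (List.le_sum_map_of_mem he N)
  have h5 : S c ≤ (t.children.map S).sum := List.le_sum_map_of_mem hc S
  omega

end IsSymbolic

end PTree

/-! ### From recognizable functions to automata -/

namespace QSDA

variable {L : FirstOrder.Language.{u, v}} {D : Type*} [L.Structure D] {PV Y : Type*} [Fintype PV]
  [DecidableEq PV] [Fintype Y] [DecidableEq Y] {F : DataFormulas L D PV Y}

/-- The automaton of a finite bottom-up evaluation.  A state consists of a value `x` and of the set
of variables that have been read; the run stops at the values `x` with `bad x`. -/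
noncomputable def ofStep {n N : ℕ} (enc : Fin n × Finset (PV ⊕ Y) ≃ Fin N)
    (step : Label PV Y → List (Fin n) → Fin n) (bad : Fin n → Prop) (out : Fin n → F.Formulas) :
    QSDA F where
  Q := Fin N
  step qs a := open Classical in
    if Fintype.card PV < qs.length ∨ bad (step a (qs.map fun q => (enc.symm q).1)) then none
    else some (enc (step a (qs.map fun q => (enc.symm q).1),
      Finset.univ.filter fun w => w ∈ Label.vars a ∨ ∃ q ∈ qs, w ∈ (enc.symm q).2))
  step_rank _ _ h := if_pos (Or.inl h)
  type q := (enc.symm q).2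
  out q := out (enc.symm q).1

variable {n N : ℕ} {enc : Fin n × Finset (PV ⊕ Y) ≃ Fin N}
  {step : Label PV Y → List (Fin n) → Fin n} {bad : Fin n → Prop} {out : Fin n → F.Formulas}
  {e : PTree PV Y → Fin n}

theorem eq_of_mem_reach_ofStep (he : ∀ a cs, e (.node a cs) = step a (cs.map e))
    {t : PTree PV Y} {q : Fin N} (hq : q ∈ (ofStep enc step bad out).reach t) :
    q = enc (e t, PTree.vars t) ∧ ¬ bad (e t) := by
  classical
  induction t using OTree.induction generalizing q with
  | h a cs ih =>
    rw [reach] at hq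
    obtain ⟨qs, hqs, htr⟩ := hq
    have hqs' : qs = cs.map fun c => enc (e c, PTree.vars c) := by
      rw [List.forall₂_map_right_iff] at hqs
      clear htr
      induction hqs with
      | nil => rfl
      | cons h _ ih' =>
        rw [List.map_cons, ← ih' fun c hc => ih c (List.mem_cons_of_mem _ hc),
          (ih _ (List.mem_cons_self ..) h).1]
        rfl
    subst hqs'
    have := htr.step_eq
    simp only [ofStep] at this
    split_ifs at this with hcond
    simp only [not_or, List.map_map, Function.comp_def, Equiv.symm_apply_apply] at hcond this
    rw [show (List.map (fun c => e c) cs) = cs.map e from rfl, ← he] at hcond this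
    refine ⟨?_, hcond.2⟩
    rw [← Option.some_injective _ this]
    congr 2
    ext w
    simp only [Finset.mem_filter, Finset.mem_univ, true_and, List.mem_map, PTree.mem_vars,
      OTree.mem_nodes_node]
    constructor
    · rintro (hw | ⟨_, ⟨c, hc, rfl⟩, hw⟩)
      · exact ⟨_, Or.inl rfl, hw⟩
      · rw [Equiv.symm_apply_apply, PTree.mem_vars] at hw
        obtain ⟨s, hs, hw⟩ := hw
        exact ⟨s, Or.inr ⟨c, hc, hs⟩, hw⟩
    · rintro ⟨s, rfl | ⟨c, hc, hs⟩, hw⟩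
      · exact Or.inl hw
      · refine Or.inr ⟨_, ⟨c, hc, rfl⟩, ?_⟩
        rw [Equiv.symm_apply_apply, PTree.mem_vars]
        exact ⟨s, hs, hw⟩

theorem mem_reach_ofStep (he : ∀ a cs, e (.node a cs) = step a (cs.map e)) {t : PTree PV Y}
    (hrank : ∀ s ∈ t.nodes, s.children.length ≤ Fintype.card PV)
    (hleaf : ∀ s ∈ t.nodes, s.children = [] → s.label.1.Nonempty)
    (hdisj : ∀ s ∈ t.nodes, ∀ c ∈ s.children, Disjoint (Label.vars s.label) (PTree.vars c))
    (hbad : ∀ s ∈ t.nodes, ¬ bad (e s)) :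
    enc (e t, PTree.vars t) ∈ (ofStep enc step bad out).reach t := by
  classical
  induction t using OTree.induction with
  | h a cs ih =>
    have hself := OTree.self_mem_nodes (OTree.node a cs)
    rw [reach]
    have hvars : ∀ w, w ∈ PTree.vars (.node a cs) ↔ w ∈ Label.vars a ∨
        ∃ q ∈ cs.map fun c => enc (e c, PTree.vars c), w ∈ (enc.symm q).2 := by
      intro w
      simp only [PTree.mem_vars, OTree.mem_nodes_node, List.mem_map, exists_exists_and_eq_and,
        Equiv.symm_apply_apply]
      constructor
      · rintro ⟨s, rfl | ⟨c, hc, hs⟩, hw⟩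
        · exact Or.inl hw
        · exact Or.inr ⟨c, hc, s, hs, hw⟩
      · rintro (hw | ⟨c, hc, s, hs, hw⟩)
        · exact ⟨_, Or.inl rfl, hw⟩
        · exact ⟨s, Or.inr ⟨c, hc, hs⟩, hw⟩
    refine ⟨cs.map fun c => enc (e c, PTree.vars c), ?_, ?_, ?_, ?_, ?_⟩
    · refine List.forall₂_map_right_iff.2 (List.forall₂_map_left_iff.2 (List.forall₂_same.2 ?_))
      intro c hc
      have hsub : ∀ s ∈ c.nodes, s ∈ (OTree.node a cs).nodes := fun s hs =>
        OTree.mem_nodes_node.2 (Or.inr ⟨c, hc, hs⟩)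
      exact ih c hc (fun s hs => hrank s (hsub s hs)) (fun s hs => hleaf s (hsub s hs))
        (fun s hs => hdisj s (hsub s hs)) (fun s hs => hbad s (hsub s hs))
    · have h1 := hrank _ hself
      have h2 := hbad _ hself
      simp only [ofStep, List.map_map, Function.comp_def, Equiv.symm_apply_apply, List.length_map]
      rw [show (List.map (fun c => e c) cs) = cs.map e from rfl, ← he, if_neg]
      · congr 3
        ext w
        rw [hvars]
        simp
      · rintro (h | h)
        · exact absurd h (not_lt.2 h1)
        · exact h2 h
    · intro h
      obtain ⟨p, hp⟩ := hleaf _ hself (List.map_eq_nil_iff.1 h)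
      refine ⟨p, ?_⟩
      simp only [ofStep, Equiv.symm_apply_apply, PTree.mem_vars]
      exact ⟨_, hself, PTree.inl_mem_label_vars.2 hp⟩
    · intro q hq
      obtain ⟨c, hc, rfl⟩ := List.mem_map.1 hq
      simpa [ofStep, OTree.label] using hdisj _ hself c hc
    · intro w
      simp only [ofStep, Equiv.symm_apply_apply]
      exact hvars w

/-- A recognizable function that assigns at most one formula to each symbolic tree defines a
regular set of formula trees. -/
theorem isRegular_of_recognizable (nil : PV) {G : PTree PV Y → Set F.Formulas}
    (hG : Recognizable G) (hsub : ∀ t, PTree.IsSymbolic nil t → (G t).Subsingleton) :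
    IsRegularFormulaLanguage nil {x | PTree.IsSymbolic nil x.1 ∧ x.2 ∈ G x.1} := by
  classical
  have hnil : Recognizable fun t : PTree PV Y => ∃ c ∈ t.children, PTree.AtRoot nil c :=
    Recognizable.exists_children (P := PTree.AtRoot nil)
      (Recognizable.label.comp fun a : Label PV Y => nil ∈ a.1)
  obtain ⟨n, e, step, out, he, hout⟩ := hG.prod hnil
  have hG' : ∀ t, G t = (out (e t)).1 := fun t => by rw [← hout]
  have hnil' : ∀ t : PTree PV Y, (∃ c ∈ t.children, PTree.AtRoot nil c) = (out (e t)).2 :=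
    fun t => by rw [← hout]
  obtain ⟨N, ⟨enc⟩⟩ := Finite.exists_equiv_fin (Fin n × Finset (PV ⊕ Y))
  -- The root of a symbolic tree is its only node above a child labelled `nil`, so that stopping
  -- there rejects the whole tree and never one in which it is a proper subtree.
  let bad : Fin n → Prop := fun x => (out x).2 ∧ ¬ (out x).1.Nonempty
  let out' : Fin n → F.Formulas := fun x => if h : (out x).1.Nonempty then h.some else ⊥
  refine ⟨ofStep enc step bad out', ?_⟩
  ext ⟨t, φ⟩
  constructor
  · rintro ⟨hsym, q, hq, -, hφ⟩
    refine ⟨hsym, ?_⟩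
    dsimp only at hsym hq hφ ⊢
    obtain ⟨rfl, hgood⟩ := eq_of_mem_reach_ofStep he hq
    have hne : (out (e t)).1.Nonempty := by
      by_contra h
      exact hgood ⟨(hnil' t).mp hsym.nil_child, h⟩
    simp only [ofStep, Equiv.symm_apply_apply, out', dif_pos hne] at hφ
    rw [hG', ← hφ]
    exact hne.some_mem
  · rintro ⟨hsym, hφ⟩
    dsimp only at hsym hφ
    have hne : (out (e t)).1.Nonempty := ⟨φ, by rwa [hG'] at hφ⟩
    refine ⟨hsym, enc (e t, PTree.vars t), mem_reach_ofStep he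
      (fun s hs => hsym.length_children_le hs) hsym.leaf
      (fun s hs c hc => hsym.disjoint_vars hs hc) ?_, ?_, ?_⟩
    · rintro s hs ⟨h1, h2⟩
      obtain ⟨a, cs⟩ := t
      rcases OTree.mem_nodes_node.1 hs with rfl | ⟨c, hc, hsc⟩
      · exact h2 hne
      · rw [← hnil'] at h1
        exact hsym.not_nil_child hc hsc h1
    · simpa [ofStep] using hsym.mem_vars
    · simp only [ofStep, Equiv.symm_apply_apply, out', dif_pos hne]
      refine hsub t hsym ?_ hφ
      rw [hG']
      exact hne.some_mem

end QSDA

/-! ### Recognizable properties of symbolic trees and runs -/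

namespace PTree

variable {PV Y : Type*}

theorem recognizable_atRoot [Finite PV] [Finite Y] (p : PV) :
    Recognizable (AtRoot (Y := Y) p) :=
  Recognizable.label.comp fun a : Label PV Y => p ∈ a.1

theorem recognizable_isSymbolic [Fintype PV] [DecidableEq PV] [Finite Y] [DecidableEq Y]
    (nil : PV) : Recognizable (IsSymbolic (Y := Y) nil) := by
  have hlen : Recognizable fun t : PTree PV Y => decide (1 < t.children.length) :=
    Recognizable.fix Recognizable.label (fun _ _ l => decide (1 < l.length)) fun a cs => by
      rw [List.length_map]; rfl
  have hcount : ∀ P : PTree PV Y → Bool, Recognizable P →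
      Recognizable fun t => t.nodes.countP P = 1 := by
    intro P hP
    convert (hP.min_countP 2).comp (· = 1) using 2
    omega
  have hle : ∀ P : PTree PV Y → Bool, Recognizable P → ∀ N,
      Recognizable fun t => t.nodes.countP P ≤ N := by
    intro P hP N
    convert (hP.min_countP (N + 1)).comp (· ≤ N) using 2
    omega
  have h1 : Recognizable fun t : PTree PV Y =>
      t.nodes.countP (fun s => 1 < s.children.length) ≤ Fintype.card PV :=
    hle _ hlen _
  have h2 : Recognizable fun t : PTree PV Y =>
      ∀ s ∈ t.nodes, s.children = [] → s.label.1.Nonempty := by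
    refine Recognizable.forall_nodes (Recognizable.fix Recognizable.label
      (fun a _ l => l = [] → a.1.Nonempty) fun a cs => ?_)
    simp [OTree.children]
  have h3 : Recognizable fun t : PTree PV Y =>
      ∀ p : PV, t.nodes.countP (fun s => p ∈ s.label.1) = 1 :=
    (Recognizable.pi fun p => hcount _
      (Recognizable.label.comp fun a : Label PV Y => decide (p ∈ a.1))).comp fun f => ∀ p, f p
  have h4 : Recognizable fun t : PTree PV Y => ∃ c ∈ t.children, AtRoot nil c :=
    (recognizable_atRoot nil).exists_children
  have h5 : Recognizable fun t : PTree PV Y =>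
      ∀ y : Y, t.nodes.countP (fun s => s.label.2 = some y) = 1 :=
    (Recognizable.pi fun y => hcount _
      (Recognizable.label.comp fun a : Label PV Y => decide (a.2 = some y))).comp fun f => ∀ y, f y
  convert (h1.prod (h2.prod (h3.prod (h4.prod h5)))).comp
    fun x => x.1 ∧ x.2.1 ∧ x.2.2.1 ∧ x.2.2.2.1 ∧ x.2.2.2.2 using 2 with t
  exact ⟨fun h => ⟨h.1, h.2, h.3, h.4, h.5⟩, fun h => ⟨h.1, h.2.1, h.2.2.1, h.2.2.2.1, h.2.2.2.2⟩⟩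

theorem recognizable_coLabels [Fintype PV] [DecidableEq PV] [Fintype Y] [DecidableEq Y] (p : PV) :
    Recognizable fun t : PTree PV Y => coLabels t p := by
  have h : Recognizable fun (t : PTree PV Y) (w : PV ⊕ Y) =>
      ∃ s ∈ t.nodes, AtRoot p s ∧ w ∈ Label.vars s.label :=
    Recognizable.pi fun w => Recognizable.exists_nodes
      (Recognizable.label.comp fun a : Label PV Y => p ∈ a.1 ∧ w ∈ Label.vars a)
  classical
  convert h.comp fun f => Finset.univ.filter f using 2 with t
  ext w
  simp [coLabels]

theorem recognizable_models [Finite PV] [Finite Y] (ψ : StructPred PV) :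
    Recognizable fun t : PTree PV Y => Models t ψ := by
  induction ψ with
  | eq p q =>
    exact Recognizable.exists_nodes ((recognizable_atRoot p).comp₂ (recognizable_atRoot q) And)
  | next p q =>
    exact Recognizable.exists_nodes ((recognizable_atRoot q).comp₂
      (recognizable_atRoot p).exists_children And)
  | reach p q =>
    exact Recognizable.exists_nodes ((recognizable_atRoot q).comp₂
      (recognizable_atRoot p).exists_nodes And)
  | not ψ ih => exact ih.comp Not
  | and ψ χ ih₁ ih₂ => exact ih₁.comp₂ ih₂ And
  | or ψ χ ih₁ ih₂ => exact ih₁.comp₂ ih₂ Or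

theorem recognizable_safe [Finite PV] [DecidableEq PV] [Finite Y] (nil p : PV) :
    Recognizable (Safe (Y := Y) nil p) :=
  (recognizable_atRoot p).comp₂
    (((recognizable_atRoot p).comp₂ (recognizable_atRoot nil)
      fun x y => x → ¬ y).forall_nodes) fun x y => ¬ x ∧ y

end PTree

namespace QSDA

variable {L : FirstOrder.Language.{u, v}} {D : Type*} [L.Structure D] {PV Y : Type*} [Fintype PV]
  [DecidableEq PV] [DecidableEq Y] {F : DataFormulas L D PV Y}

theorem recognizable_reach (A : QSDA F) : Recognizable A.reach := by
  have := A.finite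
  exact Recognizable.of_step (fun a Rs => {q | ∃ qs : List A.Q,
    List.Forall₂ (fun q' R => q' ∈ R) qs Rs ∧ A.Trans qs a q}) fun a cs => by rw [reach]

theorem reach_subsingleton (A : QSDA F) (t : PTree PV Y) : (A.reach t).Subsingleton := by
  induction t using OTree.induction with
  | h a cs ih =>
    rw [reach]
    rintro q ⟨qs, hqs, hq⟩ q' ⟨qs', hqs', hq'⟩
    have : qs = qs' := by
      clear hq hq'
      rw [List.forall₂_map_right_iff] at hqs hqs'
      induction hqs generalizing qs' with
      | nil => cases hqs'; rfl
      | cons h _ ih' =>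
        cases hqs' with
        | cons h' hqs' =>
          rw [ih _ (List.mem_cons_self ..) h h',
            ih' (fun c hc => ih c (List.mem_cons_of_mem _ hc)) _ hqs']
    subst this
    exact Option.some_injective _ (hq.step_eq.symm.trans hq'.step_eq)

/-- The states in which an automaton accepts a tree. -/
def finalStates (A : QSDA F) (nil : PV) (t : PTree PV Y) : Set A.Q :=
  {q | PTree.IsSymbolic nil t ∧ q ∈ A.reach t ∧ ∀ w, w ∈ A.type q}

theorem mem_formulaTrees {A : QSDA F} {nil : PV} {t : PTree PV Y} {φ : F.Formulas} :
    (t, φ) ∈ A.formulaTrees nil ↔ ∃ q ∈ A.finalStates nil t, A.out q = φ := by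
  constructor
  · rintro ⟨h, q, hq, hw, ho⟩
    exact ⟨q, ⟨h, hq, hw⟩, ho⟩
  · rintro ⟨q, ⟨h, hq, hw⟩, ho⟩
    exact ⟨h, q, hq, hw, ho⟩

theorem formulaTrees_unique {A : QSDA F} {nil : PV} {t : PTree PV Y} {φ ψ : F.Formulas}
    (hφ : (t, φ) ∈ A.formulaTrees nil) (hψ : (t, ψ) ∈ A.formulaTrees nil) : φ = ψ := by
  obtain ⟨q, hq, rfl⟩ := mem_formulaTrees.1 hφ
  obtain ⟨q', hq', rfl⟩ := mem_formulaTrees.1 hψ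
  rw [A.reach_subsingleton t hq.2.1 hq'.2.1]

theorem recognizable_finalStates [Finite Y] (A : QSDA F) (nil : PV) :
    Recognizable (A.finalStates nil) :=
  (PTree.recognizable_isSymbolic nil).comp₂ A.recognizable_reach
    fun x R => {q | x ∧ q ∈ R ∧ ∀ w, w ∈ A.type q}

theorem recognizable_formulaTrees [Finite Y] (A : QSDA F) (nil : PV) :
    Recognizable fun t => {φ | (t, φ) ∈ A.formulaTrees nil} := by
  convert (A.recognizable_finalStates nil).comp fun X => A.out '' X using 2 with t
  ext φ
  exact mem_formulaTrees

/-- The states in which the predecessors of a symbolic tree under an update are accepted can be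
computed bottom-up. -/
def RecognizablePost (A : QSDA F) (nil : PV) (update : PTree PV Y → PTree PV Y → Prop) : Prop :=
  ∃ K : PTree PV Y → Set A.Q, Recognizable K ∧ ∀ t', PTree.IsSymbolic nil t' →
    K t' = {q | ∃ t, update t t' ∧ q ∈ A.finalStates nil t}

theorem RecognizablePost.isJoinOver {A : QSDA F} {nil : PV}
    {update : PTree PV Y → PTree PV Y → Prop} (hA : A.RecognizablePost nil update)
    (h : F.Formulas → F.Formulas) :
    ∃ J : PTree PV Y → Set F.Formulas, Recognizable J ∧ ∀ t', PTree.IsSymbolic nil t' → ∀ σ,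
      σ ∈ J t' ↔ IsJoinOver (A.formulaTrees nil) update h t' σ := by
  obtain ⟨K, hK, hKeq⟩ := hA
  refine ⟨_, hK.comp fun X => {σ | IsLUB ((fun q => h (A.out q)) '' X) σ}, fun t' ht' σ => ?_⟩
  rw [IsJoinOver, Set.mem_ofPred_eq, hKeq t' ht']
  apply iff_of_eq
  congr 1
  ext ψ
  simp only [Set.mem_image, Set.mem_ofPred_eq, mem_formulaTrees]
  constructor
  · rintro ⟨q, ⟨t, hu, hq⟩, rfl⟩
    exact ⟨t, _, ⟨q, hq, rfl⟩, hu, rfl⟩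
  · rintro ⟨t, _, ⟨q, hq, rfl⟩, hu, rfl⟩
    exact ⟨q, ⟨t, hu, hq⟩, rfl⟩

end QSDA

/-! ### Updates that relabel the nodes -/

namespace PTree

variable {PV Y : Type*}

theorem hasPointer_node {a : Label PV Y} {cs : List (PTree PV Y)} :
    HasPointer (.node a cs) ↔ a.1.Nonempty ∨ ∃ c ∈ cs, HasPointer c := by
  constructor
  · rintro ⟨s, hs, hp⟩
    rcases OTree.mem_nodes_node.1 hs with rfl | ⟨c, hc, hsc⟩
    · exact Or.inl hp
    · exact Or.inr ⟨c, hc, s, hsc, hp⟩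
  · rintro (hp | ⟨c, hc, s, hsc, hp⟩)
    · exact ⟨_, OTree.self_mem_nodes _, hp⟩
    · exact ⟨s, OTree.mem_nodes_node.2 (Or.inr ⟨c, hc, hsc⟩), hp⟩

/-- Direct images under transformations that relabel the nodes and collect garbage. -/
theorem recognizable_image_collect [DecidableEq PV] {β γ : Type*} {f : PTree PV Y → PTree PV Y}
    {I : PTree PV Y → γ} (g : Label PV Y → List γ → Label PV Y) (hI : Recognizable I)
    (hf : ∀ a cs, f (.node a cs) =
      .node (g a (cs.map I)) ((cs.map f).filter fun c => HasPointer c))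
    {H : PTree PV Y → β} (hH : Recognizable H) :
    Recognizable fun t' => {b | ∃ t, f t = t' ∧ H t = b} := by
  refine Recognizable.image g hI ?_ hf hH
  refine Recognizable.fix hI
    (fun _ a l => decide ((g a (l.map Prod.snd)).1.Nonempty ∨ ∃ x ∈ l, x.1 = true))
    fun a cs => ?_
  simp only [hf, hasPointer_node, List.map_map, Function.comp_def, List.mem_filter, List.mem_map,
    decide_eq_decide]
  refine or_congr Iff.rfl ⟨?_, ?_⟩
  · rintro ⟨_, ⟨⟨c, hc, rfl⟩, -⟩, h⟩
    exact ⟨_, ⟨c, hc, rfl⟩, decide_eq_true h⟩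
  · rintro ⟨_, ⟨c, hc, rfl⟩, h⟩
    exact ⟨f c, ⟨⟨c, hc, rfl⟩, h⟩, of_decide_eq_true h⟩

end PTree

namespace QSDA

open PTree

variable {L : FirstOrder.Language.{u, v}} {D : Type*} [L.Structure D] {PV Y : Type*} [Fintype PV]
  [DecidableEq PV] [Finite Y] [DecidableEq Y] {F : DataFormulas L D PV Y}

theorem recognizablePost_assign (A : QSDA F) (nil p q : PV) :
    A.RecognizablePost nil (UpdateAssign p q) := by
  have h := recognizable_image_collect (f := fun t : PTree PV Y => collect (movePtr p q t))
    (fun a _ => (if q ∈ a.1 then insert p a.1 else a.1.erase p, a.2)) (Recognizable.const ())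
    (fun a cs => by simp [movePtr, OTree.relabel, collect, Function.comp_def])
    (A.recognizable_finalStates nil)
  refine ⟨_, h.comp Set.sUnion, fun t' _ => ?_⟩
  ext x
  constructor
  · rintro ⟨_, ⟨t, rfl, rfl⟩, hx⟩
    exact ⟨t, rfl, hx⟩
  · rintro ⟨t, rfl, hx⟩
    exact ⟨_, ⟨t, rfl, rfl⟩, hx⟩

theorem recognizablePost_load (A : QSDA F) (nil p q : PV) :
    A.RecognizablePost nil (UpdateLoad nil p q) := by
  have h := recognizable_image_collect (f := fun t : PTree PV Y => collect (movePtrNext p q t))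
    (fun a bs => (if ∃ b ∈ bs, q ∈ b.1 then insert p a.1 else a.1.erase p, a.2))
    Recognizable.label
    (fun a cs => by simp [movePtrNext, OTree.relabel, collect, Function.comp_def])
    ((A.recognizable_finalStates nil).comp₂ (recognizable_safe nil q)
      fun X s => {x | s ∧ x ∈ X})
  refine ⟨_, h.comp Set.sUnion, fun t' _ => ?_⟩
  ext x
  constructor
  · rintro ⟨_, ⟨t, rfl, rfl⟩, hs, hx⟩
    exact ⟨t, ⟨hs, rfl⟩, hx⟩
  · rintro ⟨t, ⟨hs, rfl⟩, hx⟩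
    exact ⟨_, ⟨t, rfl, rfl⟩, hs, hx⟩

theorem recognizablePost_new (A : QSDA F) (nil p : PV) (y : Option Y) :
    A.RecognizablePost nil (UpdateNew p y) := by
  have := A.finite
  have h := recognizable_image_collect (f := fun t : PTree PV Y => collect (eraseVars p y t))
    (fun a _ => (a.1.erase p, if a.2 = y then none else a.2)) (Recognizable.const ())
    (fun a cs => by simp [eraseVars, OTree.relabel, collect, Function.comp_def])
    (A.recognizable_finalStates nil)
  obtain ⟨n, e, step, out, he, hout⟩ := h.comp Set.sUnion
  have hleaf : Recognizable fun t : PTree PV Y => t = .node ({p}, y) [] :=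
    Recognizable.fix Recognizable.label (fun a _ l => a = ({p}, y) ∧ l = []) fun a cs => by
      simp [OTree.label]
  have he' : Recognizable e := Recognizable.of_step step he
  -- The value at the root without its last child is computed from those at its other children.
  refine ⟨fun t' => {x | ∃ t, t' = addChild (.node ({p}, y) []) t ∧ x ∈ out (e t)},
    Recognizable.fix (he'.prod hleaf) (fun _ a l => {x | ∃ l₀ z, l = l₀ ++ [z] ∧ z.2.2 ∧
      x ∈ out (step a (l₀.map fun z => z.2.1))}) fun a cs => ?_, fun t' _ => ?_⟩
  · ext x
    constructor
    · rintro ⟨⟨b, cs₀⟩, h, hx⟩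
      rw [addChild, OTree.node.injEq] at h
      obtain ⟨rfl, rfl⟩ := h
      refine ⟨_, _, List.map_append, rfl, ?_⟩
      simpa [Function.comp_def, he] using hx
    · rintro ⟨l₀, z, hl, hz, hx⟩
      rw [List.map_eq_append_iff] at hl
      obtain ⟨cs₀, cs₁, rfl, rfl, h1⟩ := hl
      rw [List.map_eq_singleton_iff] at h1
      obtain ⟨c, rfl, rfl⟩ := h1
      refine ⟨.node a cs₀, by rw [addChild]; simpa using hz, ?_⟩
      simpa [Function.comp_def, he] using hx
  · ext x
    constructor
    · rintro ⟨_, rfl, hx⟩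
      rw [← hout] at hx
      obtain ⟨_, ⟨t, rfl, rfl⟩, hx⟩ := hx
      exact ⟨t, rfl, hx⟩
    · rintro ⟨t, rfl, hx⟩
      refine ⟨_, rfl, ?_⟩
      rw [← hout]
      exact ⟨_, ⟨t, rfl, rfl⟩, hx⟩

end QSDA

/-! ### Moving a subtree -/

namespace PTree

variable {PV Y : Type*}

theorem atRoot_collect {q : PV} {t : PTree PV Y} : AtRoot q (collect t) ↔ AtRoot q t := by
  cases t; rw [collect]; exact Iff.rfl

theorem collect_eq_self {t : PTree PV Y} (h : ∀ s ∈ t.nodes, HasPointer s) : collect t = t := by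
  induction t using OTree.induction with
  | h a cs ih =>
    have hsub : ∀ c ∈ cs, ∀ s ∈ c.nodes, HasPointer s := fun c hc s hs =>
      h s (OTree.mem_nodes_node.2 (Or.inr ⟨c, hc, hs⟩))
    have h1 : cs.map collect = cs := by
      rw [List.map_congr_left fun c hc => ih c hc (hsub c hc), List.map_id']
    rw [collect, h1, List.filter_eq_self.2]
    exact fun c hc => decide_eq_true (hsub c hc c (OTree.self_mem_nodes c))

/-- Above the subtrees at `p`, which are not inspected, every node labelled `q` has exactly one
child labelled `p`, its last one, and no other node has a child labelled `p`. -/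
inductive AttachedAt (p q : PV) : PTree PV Y → Prop
  | other {a : Label PV Y} {cs : List (PTree PV Y)} (hq : q ∉ a.1)
      (hp : ∀ c ∈ cs, ¬ AtRoot p c) (hcs : ∀ c ∈ cs, AttachedAt p q c) : AttachedAt p q (.node a cs)
  | parent {a : Label PV Y} {cs : List (PTree PV Y)} {s : PTree PV Y} (hq : q ∈ a.1)
      (hs : AtRoot p s) (hp : ∀ c ∈ cs, ¬ AtRoot p c) (hcs : ∀ c ∈ cs, AttachedAt p q c) :
      AttachedAt p q (.node a (cs ++ [s]))

theorem recognizable_attachedAt [Finite PV] [Finite Y] (p q : PV) :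
    Recognizable (AttachedAt (Y := Y) p q) := by
  refine Recognizable.fix (recognizable_atRoot p) (fun _ a l =>
    (q ∉ a.1 ∧ (∀ x ∈ l, ¬ x.2) ∧ ∀ x ∈ l, x.1) ∨
    (q ∈ a.1 ∧ ∃ l₀ z, l = l₀ ++ [z] ∧ z.2 ∧ (∀ x ∈ l₀, ¬ x.2) ∧ ∀ x ∈ l₀, x.1)) fun a cs => ?_
  rw [eq_iff_iff]
  constructor
  · intro h
    cases h with
    | other hq hp hcs => exact Or.inl ⟨hq, by simpa using hp, by simpa using hcs⟩
    | parent hq hs hp hcs =>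
      exact Or.inr ⟨hq, _, _, List.map_append, hs, by simpa using hp, by simpa using hcs⟩
  · rintro (⟨hq, hp, hcs⟩ | ⟨hq, l₀, z, hl, hz, hp, hcs⟩)
    · exact .other hq (by simpa using hp) (by simpa using hcs)
    · rw [List.map_eq_append_iff] at hl
      obtain ⟨cs₀, cs₁, rfl, rfl, h1⟩ := hl
      rw [List.map_eq_singleton_iff] at h1
      obtain ⟨c, rfl, rfl⟩ := h1
      exact .parent hq hz (by simpa using hp) (by simpa using hcs)

variable [DecidableEq PV]

theorem atRoot_cut {p q : PV} {t : PTree PV Y} : AtRoot q (cut p t) ↔ AtRoot q t := by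
  cases t; rw [cut]; exact Iff.rfl

theorem atRoot_graft {p q : PV} {s t : PTree PV Y} : AtRoot q (graft p s t) ↔ AtRoot q t := by
  cases t; rw [graft]; exact Iff.rfl

/-- Cutting off the subtrees at `p` and collecting garbage, in one recursion. -/
theorem collect_cut_node (p : PV) (a : Label PV Y) (cs : List (PTree PV Y)) :
    collect (cut p (.node a cs)) = .node a ((cs.map fun c => collect (cut p c)).filter
      fun c => ¬ AtRoot p c ∧ HasPointer c) := by
  rw [cut, collect, List.filter_map, List.filter_map, List.filter_map, List.filter_filter,
    List.filter_map, List.map_map]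
  refine congrArg (fun l => OTree.node a (l.map fun c => collect (cut p c)))
    (List.filter_congr fun c _ => ?_)
  simp [atRoot_cut, atRoot_collect, Bool.and_comm]

theorem not_atRoot_of_mem_collect_cut {p : PV} {t : PTree PV Y} (ht : ¬ AtRoot p t) :
    ∀ s ∈ (collect (cut p t)).nodes, ¬ AtRoot p s := by
  induction t using OTree.induction with
  | h a cs ih =>
    intro s hs
    rw [collect_cut_node] at hs
    rcases OTree.mem_nodes_node.1 hs with rfl | ⟨c, hc, hsc⟩
    · exact ht
    · simp only [List.mem_filter, List.mem_map, decide_eq_true_eq] at hc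
      obtain ⟨⟨c, hc, rfl⟩, hpc, -⟩ := hc
      rw [atRoot_collect, atRoot_cut] at hpc
      exact ih c hc hpc s hsc

theorem collect_graft {q : PV} {s t : PTree PV Y} (hs : HasPointer s) (hsc : collect s = s) :
    collect (graft q s t) = graft q s (collect t) := by
  induction t using OTree.induction with
  | h a cs ih =>
    have hp : ∀ t : PTree PV Y, HasPointer (graft q s t) ↔ HasPointer t := by
      intro t
      induction t using OTree.induction with
      | h a cs ih =>
        rw [graft, hasPointer_node, hasPointer_node]
        by_cases hq : q ∈ a.1
        · simp [show a.1.Nonempty from ⟨q, hq⟩]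
        · simp only [if_neg hq, List.append_nil, List.mem_map, exists_exists_and_eq_and]
          exact or_congr Iff.rfl (exists_congr fun c => and_congr_right (ih c))
    rw [graft, collect, collect, graft, List.map_append, List.filter_append, List.map_map,
      List.map_congr_left (f := collect ∘ graft q s) ih]
    congr 2
    · rw [show (cs.map fun c => graft q s (collect c)) = (cs.map collect).map (graft q s) by
        rw [List.map_map]; rfl, List.filter_map]
      congr 1
      refine List.filter_congr fun c _ => ?_
      simp [hp]
    · split_ifs <;> simp [hsc, hs]

theorem cut_graft {p q : PV} {s t : PTree PV Y} (hs : AtRoot p s)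
    (ht : ∀ u ∈ t.nodes, ¬ AtRoot p u) : cut p (graft q s t) = t := by
  induction t using OTree.induction with
  | h a cs ih =>
    have hsub : ∀ c ∈ cs, ∀ u ∈ c.nodes, ¬ AtRoot p u := fun c hc u hu =>
      ht u (OTree.mem_nodes_node.2 (Or.inr ⟨c, hc, hu⟩))
    rw [graft, cut, List.map_append, List.filter_append, List.map_map,
      List.map_congr_left (f := cut p ∘ graft q s) (g := id) fun c hc => ih c hc (hsub c hc),
      List.map_id, List.filter_eq_self.2 fun c hc => decide_eq_true (hsub c hc c (OTree.self_mem_nodes c))]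
    split_ifs <;> simp [atRoot_cut, hs]

theorem mem_nodes_of_mem_graft {p q : PV} {s t u : PTree PV Y}
    (ht : ∀ u ∈ t.nodes, ¬ AtRoot p u) (hu : u ∈ (graft q s t).nodes) (hpu : AtRoot p u) :
    u ∈ s.nodes := by
  induction t using OTree.induction with
  | h a cs ih =>
    rw [graft] at hu
    rcases OTree.mem_nodes_node.1 hu with rfl | ⟨c, hc, huc⟩
    · exact absurd hpu (ht (.node a cs) (OTree.self_mem_nodes _))
    · rcases List.mem_append.1 hc with hc | hc
      · obtain ⟨c, hc', rfl⟩ := List.mem_map.1 hc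
        exact ih c hc' (fun u hu => ht u (OTree.mem_nodes_node.2 (Or.inr ⟨c, hc', hu⟩))) huc
      · split_ifs at hc <;> simp_all

theorem attachedAt_graft {p q : PV} {s t : PTree PV Y} (hs : AtRoot p s)
    (ht : ∀ u ∈ t.nodes, ¬ AtRoot p u) : AttachedAt p q (graft q s t) := by
  induction t using OTree.induction with
  | h a cs ih =>
    have hsub : ∀ c ∈ cs, ∀ u ∈ c.nodes, ¬ AtRoot p u := fun c hc u hu =>
      ht u (OTree.mem_nodes_node.2 (Or.inr ⟨c, hc, hu⟩))
    have h1 : ∀ c ∈ cs.map (graft q s), ¬ AtRoot p c := by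
      intro c hc
      obtain ⟨c, hc', rfl⟩ := List.mem_map.1 hc
      rw [atRoot_graft]
      exact hsub c hc' c (OTree.self_mem_nodes c)
    have h2 : ∀ c ∈ cs.map (graft q s), AttachedAt p q c := by
      intro c hc
      obtain ⟨c, hc', rfl⟩ := List.mem_map.1 hc
      exact ih c hc' (hsub c hc')
    rw [graft]
    split_ifs with hq
    · exact .parent hq hs h1 h2
    · rw [List.append_nil]
      exact .other hq h1 h2

theorem AttachedAt.graft_cut {p q : PV} {s t : PTree PV Y} (h : AttachedAt p q t)
    (ht : ∀ u ∈ t.nodes, AtRoot p u → u = s) : graft q s (cut p t) = t := by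
  have aux : ∀ cs : List (PTree PV Y), (∀ c ∈ cs, ¬ AtRoot p c) →
      (∀ c ∈ cs, graft q s (cut p c) = c) →
      ((cs.map (cut p)).filter fun c => ¬ AtRoot p c).map (graft q s) = cs := by
    intro cs h1 h2
    rw [List.filter_eq_self.2, List.map_map, List.map_congr_left (f := graft q s ∘ cut p) (g := id) h2, List.map_id]
    intro c hc
    obtain ⟨c, hc', rfl⟩ := List.mem_map.1 hc
    simpa [atRoot_cut] using h1 c hc'
  induction h with
  | @other a cs hq hp hcs ih =>
    rw [cut, graft, if_neg hq, List.append_nil, aux cs hp fun c hc => ih c hc fun u hu =>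
      ht u (OTree.mem_nodes_node.2 (Or.inr ⟨c, hc, hu⟩))]
  | @parent a cs s' hq hs hp hcs ih =>
    have h1 : s' = s := ht s' (OTree.mem_nodes_of_mem_children (by simp [OTree.children])) hs
    subst h1
    rw [cut, graft, if_pos hq, List.map_append, List.filter_append, List.map_append, aux cs hp]
    · simp [atRoot_cut, hs]
    · exact fun c hc => ih c hc fun u hu =>
        ht u (OTree.mem_nodes_node.2 (Or.inr ⟨c, List.mem_append_left _ hc, hu⟩))

/-- Replace the subtrees that are rooted at a node, other than the root, labelled `p` by `s`. -/
def plug (p : PV) (s : PTree PV Y) : PTree PV Y → PTree PV Y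
  | .node a cs => .node a (cs.map fun c => if AtRoot p c then s else plug p s c)

theorem cut_plug {p : PV} {s t : PTree PV Y} (hs : AtRoot p s) :
    cut p (plug p s t) = cut p t := by
  induction t using OTree.induction with
  | h a cs ih =>
    rw [plug, cut, cut, List.map_map]
    congr 1
    induction cs with
    | nil => rfl
    | cons c cs ih' =>
      have h1 := ih' fun c hc => ih c (List.mem_cons_of_mem _ hc)
      have h2 := ih c (List.mem_cons_self ..)
      by_cases hc : AtRoot p c
      · simp [hc, atRoot_cut, hs] at h1 ⊢
        exact h1
      · simp [hc, atRoot_cut, h2] at h1 ⊢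
        exact h1

theorem mem_nodes_plug {p : PV} {s t : PTree PV Y} (ht : ¬ AtRoot p t)
    (h : ∃ u ∈ t.nodes, AtRoot p u) : s ∈ (plug p s t).nodes := by
  induction t using OTree.induction with
  | h a cs ih =>
    obtain ⟨u, hu, hpu⟩ := h
    rw [plug]
    rcases OTree.mem_nodes_node.1 hu with rfl | ⟨c, hc, huc⟩
    · exact absurd hpu ht
    · refine OTree.mem_nodes_node.2 (Or.inr ⟨_, List.mem_map_of_mem hc, ?_⟩)
      split_ifs with h
      · exact OTree.self_mem_nodes s
      · exact ih c hc h ⟨u, huc, hpu⟩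

/-- A bottom-up evaluation does not notice the replacement of a subtree by one of equal value. -/
theorem eval_plug {σ : Type*} {e : PTree PV Y → σ} {step : Label PV Y → List σ → σ}
    (he : ∀ a cs, e (.node a cs) = step a (cs.map e)) {p : PV} {s t : PTree PV Y}
    (h : ∀ u ∈ t.nodes, AtRoot p u → e u = e s) : e (plug p s t) = e t := by
  induction t using OTree.induction with
  | h a cs ih =>
    rw [plug, he, he, List.map_map]
    congr 1
    refine List.map_congr_left fun c hc => ?_
    have hsub : ∀ u ∈ c.nodes, AtRoot p u → e u = e s := fun u hu =>
      h u (OTree.mem_nodes_node.2 (Or.inr ⟨c, hc, hu⟩))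
    simp only [Function.comp_apply]
    split_ifs with hpc
    · exact (hsub c (OTree.self_mem_nodes c) hpc).symm
    · exact ih c hc hsub

end PTree

namespace PTree

variable {PV Y : Type*} [Finite PV] [DecidableEq PV] [Finite Y]

theorem recognizable_comp_cut {β : Type*} {G : PTree PV Y → β} (hG : Recognizable G) (p : PV) :
    Recognizable fun t => G (cut p t) := by
  classical
  obtain ⟨n, e, step, out, he, hout⟩ := hG
  have key : Recognizable fun t => e (cut p t) := by
    refine Recognizable.fix (recognizable_atRoot p) (fun _ a l =>
      step a ((l.filter fun x => ¬ x.2).map Prod.fst)) fun a cs => ?_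
    rw [cut, he, List.filter_map, List.filter_map, List.map_map, List.map_map]
    refine congrArg (fun l => step a (l.map fun c => e (cut p c)))
      (List.filter_congr fun c _ => ?_)
    simp [atRoot_cut]
  simpa only [hout] using key.comp out

/-- Direct images under cutting off the subtrees at `p` and collecting garbage. -/
theorem recognizable_image_cut {β : Type*} (p : PV) {H : PTree PV Y → β} (hH : Recognizable H) :
    Recognizable fun t' => {b | ∃ t, collect (cut p t) = t' ∧ H t = b} := by
  classical
  have hp : Recognizable fun t : PTree PV Y => decide (HasPointer (collect (cut p t))) := by
    refine Recognizable.fix (recognizable_atRoot p)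
      (fun _ a l => decide (a.1.Nonempty ∨ ∃ x ∈ l, ¬ x.2 ∧ x.1 = true)) fun a cs => ?_
    rw [collect_cut_node, decide_eq_decide, hasPointer_node]
    refine or_congr Iff.rfl ⟨?_, ?_⟩
    · rintro ⟨d, hd, h⟩
      simp only [List.mem_filter, List.mem_map, decide_eq_true_eq] at hd
      obtain ⟨⟨c, hc, rfl⟩, hp, -⟩ := hd
      rw [atRoot_collect, atRoot_cut] at hp
      exact ⟨_, List.mem_map_of_mem hc, hp, decide_eq_true h⟩
    · rintro ⟨x, hx, hp, h⟩
      obtain ⟨c, hc, rfl⟩ := List.mem_map.1 hx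
      have h := of_decide_eq_true h
      refine ⟨collect (cut p c), List.mem_filter.2 ⟨List.mem_map_of_mem hc, ?_⟩, h⟩
      rw [decide_eq_true_eq, atRoot_collect, atRoot_cut]
      exact ⟨hp, h⟩
  refine Recognizable.image (fun a _ => a) (Recognizable.const ()) ?_ (collect_cut_node p) hH
  convert (recognizable_atRoot p).comp₂ hp fun x y => decide (¬ x ∧ y = true) using 2 with t
  simp [atRoot_cut, atRoot_collect]

end PTree

namespace QSDA

open PTree

variable {L : FirstOrder.Language.{u, v}} {D : Type*} [L.Structure D] {PV Y : Type*} [Fintype PV]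
  [DecidableEq PV] [DecidableEq Y] {F : DataFormulas L D PV Y}

/-- The old tree arises from the new one by moving the subtree at `p` from `q` to an unknown node,
possibly below nodes that became garbage.  Only the value of that subtree matters to the automaton,
so that it suffices to find an old tree whose subtree at `p` has the same value as the subtree at
`p` in the new tree. -/
theorem recognizablePost_store [Finite Y] (A : QSDA F) (nil p q : PV) :
    A.RecognizablePost nil (UpdateStore nil p q) := by
  obtain ⟨n, e, step, out, he, hout⟩ := (A.recognizable_finalStates nil).prod
    ((recognizable_safe nil p).prod ((recognizable_atRoot q).comp Not).forall_nodes)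
  have hfinal : ∀ t, A.finalStates nil t = (out (e t)).1 := fun t => by rw [← hout]
  have hsafe : ∀ t, Safe nil p t ↔ (out (e t)).2.1 := fun t => by rw [← hout]
  have hfree : ∀ t : PTree PV Y, (∀ u ∈ t.nodes, ¬ AtRoot q u) ↔ (out (e t)).2.2 :=
    fun t => by rw [← hout]
  have he' : Recognizable e := Recognizable.of_step step he
  set V : PTree PV Y → Set (Fin n) := fun t => {x | ∃ s ∈ t.nodes, AtRoot p s ∧ e s = x} with hV
  have hVrec : Recognizable V := by
    convert ((recognizable_atRoot p).prod he').nodes.comp fun X => {x | (True, x) ∈ X} using 2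
    ext x
    simp [hV]
  refine ⟨fun t' => {x | AttachedAt p q t' ∧ ∃ b ∈ {b | ∃ t, collect (cut p t) = cut p t' ∧
      (e t, V t) = b}, b.2 = V t' ∧ x ∈ (out b.1).1 ∧ (out b.1).2.1 ∧ ∀ y ∈ b.2, (out y).2.2},
    (recognizable_attachedAt p q).comp₂ ((recognizable_comp_cut
      (recognizable_image_cut p (he'.prod hVrec)) p).prod hVrec)
      (fun P X => {x | P ∧ ∃ b ∈ X.1, b.2 = X.2 ∧ x ∈ (out b.1).1 ∧ (out b.1).2.1 ∧
        ∀ y ∈ b.2, (out y).2.2}), fun t' ht' => ?_⟩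
  ext x
  constructor
  · rintro ⟨hatt, _, ⟨t₀, hcut, rfl⟩, hVV, hx, hs₀, hq⟩
    dsimp only at hVV hx hs₀ hq
    rw [← hfinal] at hx
    rw [← hsafe] at hs₀
    obtain ⟨s, hs, hps⟩ := ht'.exists_atRoot p
    have hes : ∀ u ∈ t₀.nodes, AtRoot p u → e u = e s := by
      intro u hu hpu
      have h1 : e u ∈ V t' := hVV ▸ ⟨u, hu, hpu, rfl⟩
      obtain ⟨u', hu', hpu', h2⟩ := h1
      rw [← h2, ht'.eq_of_atRoot hu' hs hpu' hps]
    have heq : e (plug p s t₀) = e t₀ := eval_plug he hes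
    have hsq : e s ∈ V t₀ := hVV.symm ▸ ⟨s, hs, hps, rfl⟩
    refine ⟨plug p s t₀, ⟨?_, s, mem_nodes_plug hs₀.1 (hx.1.exists_atRoot p), hps,
      (hfree s).2 (hq _ hsq), ?_⟩, ?_⟩
    · rwa [hsafe, heq, ← hsafe]
    · rw [cut_plug hps, collect_graft (ht'.hasPointer hs) (collect_eq_self fun u hu =>
        ht'.hasPointer (OTree.mem_nodes_trans hu hs)), hcut, hatt.graft_cut fun u hu hpu =>
        ht'.eq_of_atRoot hu hs hpu hps]
    · rwa [hfinal, heq, ← hfinal]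
  · rintro ⟨t, ⟨hs₀, s, hs, hps, hqs, h⟩, hx⟩
    have ht := hx.1
    rw [collect_graft (ht.hasPointer hs) (collect_eq_self fun u hu =>
      ht.hasPointer (OTree.mem_nodes_trans hu hs))] at h
    have hfree' := not_atRoot_of_mem_collect_cut hs₀.1
    have hVt : ∀ y, y ∈ V t ↔ y = e s := by
      intro y
      constructor
      · rintro ⟨u, hu, hpu, rfl⟩
        rw [ht.eq_of_atRoot hu hs hpu hps]
      · rintro rfl
        exact ⟨s, hs, hps, rfl⟩
    have hVt' : ∀ y, y ∈ V t' ↔ y = e s := by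
      have key : ∀ u ∈ t'.nodes, AtRoot p u → u = s := fun u hu hpu =>
        ht.eq_of_atRoot (OTree.mem_nodes_trans (mem_nodes_of_mem_graft hfree' (h ▸ hu) hpu) hs) hs
          hpu hps
      intro y
      constructor
      · rintro ⟨u, hu, hpu, rfl⟩
        rw [key u hu hpu]
      · rintro rfl
        obtain ⟨u, hu, hpu⟩ := ht'.exists_atRoot p
        exact ⟨u, hu, hpu, by rw [key u hu hpu]⟩
    refine ⟨?_, _, ⟨t, ?_, rfl⟩, ?_, (hfinal t).subset hx, (hsafe t).1 hs₀, ?_⟩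
    · rw [h]
      exact attachedAt_graft hps hfree'
    · rw [h, cut_graft hps hfree']
    · ext y
      rw [hVt, hVt']
    · intro y hy
      rw [(hVt y).1 hy]
      exact (hfree s).1 hqs

end QSDA

/-! ### The abstract transformer -/

section Transformer

variable {L : FirstOrder.Language.{u, v}} {D : Type*} [L.Structure D] {PV Y : Type*} [Fintype PV]
  [DecidableEq PV] [Fintype Y] [DecidableEq Y] {F : DataFormulas L D PV Y}

/-- It suffices to describe the transformer by a recognizable function and to see that it is
single-valued. -/
theorem isRegular_transformer {nil : PV} {𝓛 : Set (PTree PV Y × F.Formulas)} {s : Stmt F}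
    {G : PTree PV Y → Set F.Formulas} (hG : Recognizable G)
    (heq : ∀ t', PTree.IsSymbolic nil t' → ∀ φ, φ ∈ G t' ↔ TransformerRel nil 𝓛 t' φ s)
    (hsub : ∀ t', PTree.IsSymbolic nil t' → ∀ φ ψ, TransformerRel nil 𝓛 t' φ s →
      TransformerRel nil 𝓛 t' ψ s → φ = ψ) :
    IsRegularFormulaLanguage nil (transformer nil s 𝓛) := by
  convert QSDA.isRegular_of_recognizable nil hG fun t ht φ hφ ψ hψ =>
    hsub t ht φ ψ ((heq t ht φ).1 hφ) ((heq t ht ψ).1 hψ) using 1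
  ext ⟨t, φ⟩
  exact and_congr_right fun ht => (heq t ht φ).symm

end Transformer

theorem mainTheorem3 {L : FirstOrder.Language.{u, v}} {D : Type*} [L.Structure D] {PV Y : Type*}
    [Fintype PV] [DecidableEq PV] [Fintype Y] [DecidableEq Y] (nil : PV)
    (F : DataFormulas L D PV Y) (A : QSDA F) (s : Stmt F) :
    IsRegularFormulaLanguage nil (transformer nil s (A.formulaTrees nil)) := by
  have hcoLabels := fun p => PTree.recognizable_coLabels (PV := PV) (Y := Y) p
  cases s with
  | assignNil p =>
    obtain ⟨J, hJ, hJeq⟩ := (A.recognizablePost_assign nil p nil).isJoinOver (F.ex {.inl p})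
    exact isRegular_transformer hJ hJeq fun _ _ _ _ h₁ h₂ => h₁.unique h₂
  | assign p q =>
    obtain ⟨J, hJ, hJeq⟩ := (A.recognizablePost_assign nil p q).isJoinOver (F.ex {.inl p})
    refine isRegular_transformer (hJ.comp fun X => {φ | ∃ σ ∈ X,
      φ = F.eqData (.inl p) (.inl q) ⊓ σ}) (fun t' ht' φ => ?_) ?_
    · exact exists_congr fun σ => and_congr_left' (hJeq t' ht' σ)
    · rintro _ _ _ _ ⟨σ, h₁, rfl⟩ ⟨τ, h₂, rfl⟩
      rw [h₁.unique h₂]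
  | load p q =>
    obtain ⟨J, hJ, hJeq⟩ := (A.recognizablePost_load nil p q).isJoinOver (F.ex {.inl p})
    refine isRegular_transformer (hJ.comp₂ (hcoLabels p) fun X C => {φ | ∃ σ ∈ X,
      φ = σ ⊓ C.inf fun w => F.eqData (.inl p) w}) (fun t' ht' φ => ?_) ?_
    · exact exists_congr fun σ => and_congr_left' (hJeq t' ht' σ)
    · rintro _ _ _ _ ⟨σ, h₁, rfl⟩ ⟨τ, h₂, rfl⟩
      rw [h₁.unique h₂]
  | storeNil p =>
    obtain ⟨J, hJ, hJeq⟩ := (A.recognizablePost_store nil p nil).isJoinOver id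
    exact isRegular_transformer hJ hJeq fun _ _ _ _ h₁ h₂ => h₁.unique h₂
  | store p q =>
    obtain ⟨J, hJ, hJeq⟩ := (A.recognizablePost_store nil p q).isJoinOver id
    exact isRegular_transformer hJ hJeq fun _ _ _ _ h₁ h₂ => h₁.unique h₂
  | storeData p e =>
    refine isRegular_transformer ((A.recognizable_formulaTrees nil).comp₂ (hcoLabels p)
      fun X C => {φ' | ∃ φ ∈ X, φ' = F.ex C φ ⊓ C.inf fun w => F.eqExpr w e})
      (fun _ _ _ => Iff.rfl) ?_
    rintro _ _ _ _ ⟨φ, h₁, rfl⟩ ⟨ψ, h₂, rfl⟩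
    rw [QSDA.formulaTrees_unique h₁ h₂]
  | assumeStruct ψ =>
    exact isRegular_transformer ((A.recognizable_formulaTrees nil).comp₂
      (PTree.recognizable_models ψ) fun X P => {φ | φ ∈ X ∧ P}) (fun _ _ _ => Iff.rfl)
      fun _ _ _ _ h₁ h₂ => QSDA.formulaTrees_unique h₁.1 h₂.1
  | assumeData ψ =>
    refine isRegular_transformer ((A.recognizable_formulaTrees nil).comp
      fun X => {φ' | ∃ φ ∈ X, φ' = φ ⊓ ψ}) (fun _ _ _ => Iff.rfl) ?_
    rintro _ _ _ _ ⟨φ, h₁, rfl⟩ ⟨χ, h₂, rfl⟩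
    rw [QSDA.formulaTrees_unique h₁ h₂]
  | new p =>
    obtain ⟨J, hJ, hJeq⟩ := (A.recognizablePost_new nil p none).isJoinOver (F.ex {.inl p})
    choose J' hJ' hJeq' using fun y : Y => (A.recognizablePost_new nil p (some y)).isJoinOver
      fun φ => F.ex {.inr y} (F.ex {.inl p} φ)
    have hletter : Recognizable fun (t : PTree PV Y) (o : Option Y) =>
        ∃ s ∈ t.nodes, PTree.AtRoot p s ∧ s.label.2 = o :=
      Recognizable.pi fun o => Recognizable.exists_nodes
        (Recognizable.label.comp fun a : Label PV Y => p ∈ a.1 ∧ a.2 = o)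
    have hletter_unique : ∀ t : PTree PV Y, PTree.IsSymbolic nil t → ∀ o o',
        (∃ s ∈ t.nodes, PTree.AtRoot p s ∧ s.label.2 = o) →
        (∃ s ∈ t.nodes, PTree.AtRoot p s ∧ s.label.2 = o') → o = o' := by
      rintro t ht _ _ ⟨s, hs, hps, rfl⟩ ⟨s', hs', hps', rfl⟩
      rw [ht.eq_of_atRoot hs hs' hps hps']
    refine isRegular_transformer ((hletter.prod (hJ.prod (Recognizable.pi hJ'))).comp
      fun x => {φ | (x.1 none ∧ φ ∈ x.2.1) ∨ ∃ y, x.1 (some y) ∧ ∃ σ ∈ x.2.2 y,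
        φ = F.eqData (.inr y) (.inl p) ⊓ σ}) (fun t' ht' φ => ?_) ?_
    · exact or_congr (and_congr_right' (hJeq t' ht' φ)) (exists_congr fun y =>
        and_congr_right' (exists_congr fun σ => and_congr_left' (hJeq' y t' ht' σ)))
    · rintro t ht _ _ (⟨ho, h₁⟩ | ⟨y, ho, σ, h₁, rfl⟩) (⟨ho', h₂⟩ | ⟨y', ho', τ, h₂, rfl⟩)
      · exact h₁.unique h₂
      · exact absurd (hletter_unique t ht _ _ ho ho') (by simp)
      · exact absurd (hletter_unique t ht _ _ ho ho') (by simp)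
      · obtain rfl := Option.some_injective _ (hletter_unique t ht _ _ ho ho')
        rw [h₁.unique h₂]
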